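/- Let $\Bbbk$ be a field of characteristic zero and let $(\mathcal C,\otimes,\mathbf 1)$ be an abelian $\Bbbk$-linear monoidal category with finite-dimensional morphism spaces and $\Bbbk$-bilinear tensor product, whose tensor unit is simple and absolutely simple, i.e. $\mathrm{End}(\mathbf 1)=\Bbbk\,\mathrm{id}_{\mathbf 1}$. Let $\mathcal C$ be sovereign: it is equipped with a right duality $b_X:\mathbf 1\to X\otimes X^\vee$, $d_X:X^\vee\otimes X\to\mathbf 1$ and a left duality $\tilde b_X:\mathbf 1\to X^\vee\otimes X$, $\tilde d_X:X\otimes X^\vee\to\mathbf 1$ which coincide as functors (same dual objects $X^\vee$, same dual morphisms $f^\vee$). Let $(A,m,\eta,\Delta,\epsilon)$ be a symmetric normalised special Frobenius algebra in $\mathcal C$ (so $m\circ\Delta=\mathrm{id}_A$ and $\epsilon\circ\eta$ is a nonzero multiple of $\mathrm{id}_{\mathbf 1}$) which is simple and absolutely simple as a bimodule over itself. Let $\mathcal C_{A|A}$ be the monoidal category of $A$-bimodules with tensor product $\otimes_A$ and unit $A$, and let $\mathrm{Pic}(\mathcal C_{A|A})$ be the group of isomorphism classes of its $\otimes_A$-invertible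 objects. The left and right dimensions in $\mathcal C_{A|A}$ of a bimodule $M$ are the scalars by which the endomorphisms $d^A_M\circ\tilde b^A_M$ and $\tilde d^A_M\circ b^A_M$ of $A$ act, where (with $M^\vee$ carrying the dual actions) $b^A_M:A\to M\otimes_A M^\vee$ and $\tilde b^A_M:A\to M^\vee\otimes_A M$ are $b_M$ and $\tilde b_M$ combined with the action of $A$ on $M$ from the left and from the right, respectively, and $d^A_M:M^\vee\otimes_A M\to A$ and $\tilde d^A_M:M\otimes_A M^\vee\to A$ are obtained by creating $\Delta\circ\eta$ to the right (respectively to the left), letting its leg adjacent to $M$ act on $M$, and applying $d_M$ (respectively $\tilde d_M$). Let $H\le\mathrm{Pic}(\mathcal C_{A|A})$ be a finite subgroup with representatives $L_h$, $h\in H$, such that the left or the right dimension of $\bigoplus_{h\in H}L_h$ in $\mathcal C_{A|A}$ is nonzero. Then there exist an algebra $A'$ in $\mathcal C$, an $A$-$A'$-bimodule $P$ and an $A'$-$A$-bimodule $P'$ forming a Morita context $(A,A',P,P')$ in $\mathcal C$, i.e. there are bimodule isomorphisms $f:P\otimes_{A'}P'\to A$ and $g:P'\otimes_A P\to A'$ for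 which the two maps $(P\otimes_{A'}P')\otimes_A P\to P$ built from $f$ and from $g$ agree, and likewise the two maps $(P'\otimes_A P)\otimes_{A'}P'\to P'$, such that for every $h\in H$ there is an algebra automorphism $\beta_h$ of $A'$ and an isomorphism of $A'$-bimodules $${}_{\mathrm{id}}A'_{\beta_h}\;\cong\;(P'\otimes_A L_h)\otimes_A P .$$ Here ${}_{\mathrm{id}}A'_{\beta}$ is the object $A'$ with left action $m_{A'}$ and right action $m_{A'}\circ(\mathrm{id}_{A'}\otimes\beta)$. In other words, the isomorphism of Picard groups $[X]\mapsto[P'\otimes_A X\otimes_A P]$ maps $H$ into the image of $\beta\mapsto[{}_{\mathrm{id}}A'_\beta]$. -/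

import Mathlib

open CategoryTheory MonoidalCategory Limits

universe v u w

namespace BimodPicard

/-! ### Sovereign monoidal categories -/

/-- A sovereign category: a monoidal category equipped with a right duality
`(b, d)` and a left duality `(b̃, d̃)` which coincide as functors, i.e. they assign the same dual
object to each object and the same dual morphism to each morphism. (The two dualities are not
required to coincide as monoidal functors.) -/
class SovereignCategory (C : Type u) [Category.{v} C] [MonoidalCategory C] where
  /-- The common (right and left) dual object. -/
  dual : C → C
  /-- The right duality: `b : 𝟙_ C ⟶ X ⊗ dual X` and `d : dual X ⊗ X ⟶ 𝟙_ C`. -/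
  rightDuality (X : C) : ExactPairing X (dual X)
  /-- The left duality: `b̃ : 𝟙_ C ⟶ dual X ⊗ X` and `d̃ : X ⊗ dual X ⟶ 𝟙_ C`. -/
  leftDuality (X : C) : ExactPairing (dual X) X
  /-- The right dual and the left dual of a morphism coincide. -/
  rightMate_eq_leftMate {X Y : C} (f : X ⟶ Y) :
    @rightAdjointMate C _ _ X Y
        (@HasRightDual.mk C _ _ X (dual X) (rightDuality X))
        (@HasRightDual.mk C _ _ Y (dual Y) (rightDuality Y)) f =
      @leftAdjointMate C _ _ X Y
        (@HasLeftDual.mk C _ _ X (dual X) (leftDuality X))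
        (@HasLeftDual.mk C _ _ Y (dual Y) (leftDuality Y)) f

/-! In names, a prime stands for the tilde of the left duality. -/

namespace SovereignCategory

variable {C : Type u} [Category.{v} C] [MonoidalCategory C] [SovereignCategory C]

/-- `b_X`, the coevaluation of the right duality. -/
def b (X : C) : 𝟙_ C ⟶ X ⊗ dual X := (rightDuality X).coevaluation'

/-- `d_X`, the evaluation of the right duality. -/
def d (X : C) : dual X ⊗ X ⟶ 𝟙_ C := (rightDuality X).evaluation'

/-- `b̃_X`, the coevaluation of the left duality. -/
def b' (X : C) : 𝟙_ C ⟶ dual X ⊗ X := (leftDuality X).coevaluation'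

/-- `d̃_X`, the evaluation of the left duality. -/
def d' (X : C) : X ⊗ dual X ⟶ 𝟙_ C := (leftDuality X).evaluation'

theorem b_d (X : C) : b X ▷ X ⊗≫ X ◁ d X = ⊗𝟙.hom :=
  @ExactPairing.evaluation_coevaluation'' C _ _ X (dual X) (rightDuality X)

theorem b'_d' (X : C) : X ◁ b' X ⊗≫ d' X ▷ X = ⊗𝟙.hom :=
  @ExactPairing.coevaluation_evaluation'' C _ _ (dual X) X (leftDuality X)

instance preservesColimits_tensorLeft (X : C) :
    PreservesColimitsOfSize.{0, 0} (tensorLeft X) :=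
  (@tensorLeftAdjunction C _ _ (dual X) X (leftDuality X)).leftAdjoint_preservesColimits

instance preservesColimits_tensorRight (X : C) :
    PreservesColimitsOfSize.{0, 0} (tensorRight X) :=
  (@tensorRightAdjunction C _ _ X (dual X) (rightDuality X)).leftAdjoint_preservesColimits

end SovereignCategory

/-! ### The category of bimodules: additive and monoidal structure -/

section Preadditive

variable {C : Type u} [Category.{v} C] [MonoidalCategory C] [Preadditive C] [MonoidalPreadditive C]
variable {A B : Mon C}

instance (M N : Bimod A B) : Zero (M ⟶ N) := ⟨({ hom := 0 } : Bimod.Hom M N)⟩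

instance (M N : Bimod A B) : Add (M ⟶ N) :=
  ⟨fun f g => ({ hom := f.hom + g.hom } : Bimod.Hom M N)⟩

instance (M N : Bimod A B) : Neg (M ⟶ N) :=
  ⟨fun f => ({
    hom := -f.hom
    left_act_hom := by
      have h : A.X ◁ (-f.hom) = -(A.X ◁ f.hom) := (tensorLeft A.X).map_neg
      rw [h, Preadditive.comp_neg, Preadditive.neg_comp, Bimod.Hom.left_act_hom]
    right_act_hom := by
      have h : (-f.hom) ▷ B.X = -(f.hom ▷ B.X) := (tensorRight B.X).map_neg
      rw [h, Preadditive.comp_neg, Preadditive.neg_comp, Bimod.Hom.right_act_hom] } :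
      Bimod.Hom M N)⟩

@[simp] theorem zero_hom (M N : Bimod A B) : (0 : M ⟶ N).hom = 0 := rfl

@[simp] theorem add_hom {M N : Bimod A B} (f g : M ⟶ N) : (f + g).hom = f.hom + g.hom := rfl

@[simp] theorem neg_hom {M N : Bimod A B} (f : M ⟶ N) : (-f).hom = -f.hom := rfl

/-- Bimodule morphisms are added in the ambient category. -/
instance : Preadditive (Bimod A B) where
  homGroup M N :=
    { add_assoc := fun f g h => by ext; simp [add_assoc]
      zero_add := fun f => by ext; simp
      add_zero := fun f => by ext; simp
      nsmul := nsmulRec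
      zsmul := zsmulRec
      neg_add_cancel := fun f => by ext; simp
      add_comm := fun f g => by ext; simp [add_comm] }
  add_comp := fun _ _ _ f f' g => by ext; simp
  comp_add := fun _ _ _ f g g' => by ext; simp

theorem sum_hom {M N : Bimod A B} {J : Type*} (s : Finset J) (f : J → (M ⟶ N)) :
    (∑ i ∈ s, f i).hom = ∑ i ∈ s, (f i).hom :=
  map_sum (AddMonoidHom.mk' (fun f : M ⟶ N => f.hom) (fun _ _ => rfl)) f s

section Biproducts

set_option linter.unusedSectionVars false

variable [HasFiniteBiproducts C] {n : ℕ}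

/-- The componentwise left action on a direct sum. -/
noncomputable def directSumActLeft (M : Fin n → Bimod A B) :
    A.X ⊗ (⨁ fun i => (M i).X) ⟶ ⨁ fun i => (M i).X :=
  biproduct.lift fun i => A.X ◁ biproduct.π _ i ≫ (M i).actLeft

/-- The componentwise right action on a direct sum. -/
noncomputable def directSumActRight (M : Fin n → Bimod A B) :
    (⨁ fun i => (M i).X) ⊗ B.X ⟶ ⨁ fun i => (M i).X :=
  biproduct.lift fun i => biproduct.π _ i ▷ B.X ≫ (M i).actRight

theorem directSumActLeft_π (M : Fin n → Bimod A B) (i : Fin n) :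
    directSumActLeft M ≫ biproduct.π _ i = A.X ◁ biproduct.π _ i ≫ (M i).actLeft :=
  biproduct.lift_π _ _

theorem directSumActRight_π (M : Fin n → Bimod A B) (i : Fin n) :
    directSumActRight M ≫ biproduct.π _ i = biproduct.π _ i ▷ B.X ≫ (M i).actRight :=
  biproduct.lift_π _ _

/-- The direct sum of finitely many bimodules, with the componentwise actions. -/
noncomputable def directSum (M : Fin n → Bimod A B) : Bimod A B where
  X := ⨁ fun i => (M i).X
  actLeft := directSumActLeft M
  actRight := directSumActRight M
  one_actLeft := by
    refine biproduct.hom_ext _ _ fun i => ?_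
    rw [Category.assoc, directSumActLeft_π, ← whisker_exchange_assoc, Bimod.one_actLeft,
      leftUnitor_naturality]
  left_assoc := by
    refine biproduct.hom_ext _ _ fun i => ?_
    simp only [Category.assoc, directSumActLeft_π]
    rw [← whisker_exchange_assoc, Bimod.left_assoc, ← whiskerLeft_comp_assoc, directSumActLeft_π]
    simp
  actRight_one := by
    refine biproduct.hom_ext _ _ fun i => ?_
    rw [Category.assoc, directSumActRight_π, whisker_exchange_assoc, Bimod.actRight_one,
      rightUnitor_naturality]
  right_assoc := by
    refine biproduct.hom_ext _ _ fun i => ?_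
    simp only [Category.assoc, directSumActRight_π]
    rw [whisker_exchange_assoc, Bimod.right_assoc, ← comp_whiskerRight_assoc,
      directSumActRight_π]
    simp
  middle_assoc := by
    refine biproduct.hom_ext _ _ fun i => ?_
    simp only [Category.assoc, directSumActRight_π, directSumActLeft_π]
    rw [← comp_whiskerRight_assoc, directSumActLeft_π, ← whiskerLeft_comp_assoc,
      directSumActRight_π]
    simp

/-- The direct sum as a bicone in the category of bimodules. -/
noncomputable def directSumBicone (M : Fin n → Bimod A B) : Bicone M where
  pt := directSum M
  π i := ({ hom := biproduct.π (fun i => (M i).X) i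
            left_act_hom := directSumActLeft_π M i
            right_act_hom := directSumActRight_π M i } : Bimod.Hom (directSum M) (M i))
  ι i := ({ hom := biproduct.ι (fun i => (M i).X) i
            left_act_hom := by
              refine biproduct.hom_ext _ _ fun j => ?_
              simp only [directSum, Category.assoc, directSumActLeft_π]
              rw [← whiskerLeft_comp_assoc]
              by_cases h : i = j
              · subst h; simp
              · simp [biproduct.ι_π_ne _ h]
            right_act_hom := by
              refine biproduct.hom_ext _ _ fun j => ?_
              simp only [directSum, Category.assoc, directSumActRight_π]
              rw [← comp_whiskerRight_assoc]
              by_cases h : i = j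
              · subst h; simp
              · simp [biproduct.ι_π_ne _ h] } : Bimod.Hom (M i) (directSum M))
  ι_π i j := by
    by_cases h : i = j
    · subst h
      simp only [dite_true, eqToHom_refl]
      ext
      exact biproduct.ι_π_self _ _
    · simp only [h, dite_false]
      ext
      exact biproduct.ι_π_ne _ h

theorem hasFiniteBiproducts_bimod : HasFiniteBiproducts (Bimod A B) :=
  ⟨fun n => ⟨fun M => hasBiproduct_of_total (directSumBicone M) (by
    ext
    rw [sum_hom]
    refine (Finset.sum_congr rfl fun i _ => Bimod.comp_hom' _ _).trans ?_
    exact biproduct.total (f := fun i => (M i).X))⟩⟩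

end Biproducts

/-- Finite direct sums of bimodules exist. -/
instance [HasFiniteProducts C] : HasFiniteBiproducts (Bimod A B) :=
  haveI : HasFiniteBiproducts C := HasFiniteBiproducts.of_hasFiniteProducts
  hasFiniteBiproducts_bimod

end Preadditive

section Monoidal

variable {C : Type u} [Category.{v} C] [MonoidalCategory C] [HasCoequalizers C]
  [∀ X : C, PreservesColimitsOfSize.{0, 0} (tensorLeft X)]
  [∀ X : C, PreservesColimitsOfSize.{0, 0} (tensorRight X)]

/-- The monoidal category `C_{A|A}` of `A`-bimodules with tensor product `⊗_A`: the
endomorphism category of `A` in Mathlib's bicategory of algebras and bimodules. -/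
noncomputable instance bimodMonoidal (A : Mon C) : MonoidalCategory (Bimod A A) where
  tensorObj M N := M.tensorBimod N
  whiskerLeft M _ _ f := Bimod.whiskerLeft M f
  whiskerRight f N := Bimod.whiskerRight f N
  tensorUnit := Bimod.regular A
  associator := Bimod.associatorBimod
  leftUnitor := Bimod.leftUnitorBimod
  rightUnitor := Bimod.rightUnitorBimod
  tensorHom_def _ _ := rfl
  id_tensorHom_id M N := by
    rw [Bimod.id_whiskerRight_bimod, Bimod.whiskerLeft_id_bimod, Category.id_comp]
  tensorHom_comp_tensorHom f₁ f₂ g₁ g₂ := by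
    rw [Bimod.comp_whiskerRight_bimod, Bimod.whiskerLeft_comp_bimod, Category.assoc,
      Category.assoc, ← Category.assoc (Bimod.whiskerLeft _ f₂), Bimod.whisker_exchange_bimod]
    simp only [Category.assoc]
  whiskerLeft_id _ _ := Bimod.whiskerLeft_id_bimod
  id_whiskerRight _ _ := Bimod.id_whiskerRight_bimod
  associator_naturality {M₁ M₂ M₃ N₁ N₂ N₃} f₁ f₂ f₃ := by
    exact @MonoidalCategory.associator_naturality (Bimod A A) _
      (@CategoryTheory.instMonoidalCategoryHom (Mon C) Bimod.monBicategory A) _ _ _ _ _ _ f₁ f₂ f₃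
  leftUnitor_naturality f := by
    rw [Bimod.id_whiskerLeft_bimod]
    simp
  rightUnitor_naturality f := by
    rw [Bimod.whiskerRight_id_bimod]
    simp
  pentagon _ _ _ _ := Bimod.pentagon_bimod _ _ _ _
  triangle _ _ := Bimod.triangle_bimod _ _

/-- The Picard group `Pic(D)` of a monoidal category `D`: the isomorphism classes of those objects
that have an inverse under the tensor product, i.e. the units of the monoid of isomorphism
classes. -/
abbrev Pic (D : Type u) [Category.{v} D] [MonoidalCategory D] : Type u := (Skeleton D)ˣ

/-- The twisted bimodule `_id A_β`: the object `A` with left action the multiplication and right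
action the multiplication precomposed with the algebra automorphism `β` on the acting factor. -/
def twistedBimod {A : Mon C} (β : A ≅ A) : Bimod A A where
  X := A.X
  actLeft := MonObj.mul
  actRight := A.X ◁ β.hom.hom ≫ MonObj.mul
  actRight_one := by
    rw [← whiskerLeft_comp_assoc, IsMonHom.one_hom, MonObj.mul_one]
  right_assoc := by
    rw [← whiskerLeft_comp_assoc, IsMonHom.mul_hom, comp_whiskerRight, Category.assoc,
      ← whisker_exchange_assoc, MonObj.mul_assoc]
    simp [MonoidalCategory.tensorHom_def]
  middle_assoc := by
    rw [← whisker_exchange_assoc, MonObj.mul_assoc]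
    simp

/-- A Morita context `(A, B, P, Q, f, g)`. -/
structure MoritaContext (A B : Mon C) (P : Bimod A B) (Q : Bimod B A) where
  /-- `f : P ⊗_B Q ≅ A` as `A`-bimodules. -/
  f : P.tensorBimod Q ≅ Bimod.regular A
  /-- `g : Q ⊗_A P ≅ B` as `B`-bimodules. -/
  g : Q.tensorBimod P ≅ Bimod.regular B
  /-- `(P ⊗_B Q) ⊗_A P ⟶ P` can be formed with `f` or with `g`. -/
  f_g : Bimod.whiskerRight f.hom P ≫ (Bimod.leftUnitorBimod P).hom =
    (Bimod.associatorBimod P Q P).hom ≫ Bimod.whiskerLeft P g.hom ≫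
      (Bimod.rightUnitorBimod P).hom
  /-- `(Q ⊗_A P) ⊗_B Q ⟶ Q` can be formed with `g` or with `f`. -/
  g_f : Bimod.whiskerRight g.hom Q ≫ (Bimod.leftUnitorBimod Q).hom =
    (Bimod.associatorBimod Q P Q).hom ≫ Bimod.whiskerLeft Q f.hom ≫
      (Bimod.rightUnitorBimod Q).hom

end Monoidal

/-! ### Frobenius algebras -/

section Frobenius

open SovereignCategory

variable {C : Type u} [Category.{v} C] [MonoidalCategory C]

/-- The compatibility of the algebra and the coalgebra structure of a Frobenius algebra. -/
structure IsFrobenius (A : Mon C) [ComonObj A.X] : Prop where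
  comul_mul : ComonObj.comul ▷ A.X ≫ (α_ A.X A.X A.X).hom ≫ A.X ◁ MonObj.mul =
    (MonObj.mul : A.X ⊗ A.X ⟶ A.X) ≫ ComonObj.comul
  mul_comul : A.X ◁ ComonObj.comul ≫ (α_ A.X A.X A.X).inv ≫ MonObj.mul ▷ A.X =
    (MonObj.mul : A.X ⊗ A.X ⟶ A.X) ≫ ComonObj.comul

/-- Normalised specialness: `m ∘ Δ = id_A`, and `ε ∘ η` is a nonzero multiple of `id_1`. -/
structure IsNormalizedSpecial (k : Type w) [Field k] [Preadditive C] [Linear k C]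
    (A : Mon C) [ComonObj A.X] : Prop where
  comul_mul : ComonObj.comul ≫ MonObj.mul = 𝟙 A.X
  one_counit : ∃ c : k, c ≠ 0 ∧ MonObj.one (X := A.X) ≫ ComonObj.counit = c • 𝟙 (𝟙_ C)

/-- `Φ₁ = ((ε ∘ m) ⊗ id) ∘ (id_A ⊗ b_A) : A ⟶ A^∨`. -/
def Φ₁ [SovereignCategory C] (A : Mon C) [ComonObj A.X] : A.X ⟶ dual A.X :=
  (ρ_ A.X).inv ≫ A.X ◁ b A.X ≫ (α_ A.X A.X (dual A.X)).inv ≫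
    (MonObj.mul ≫ ComonObj.counit) ▷ dual A.X ≫ (λ_ (dual A.X)).hom

/-- `Φ₂ = (id ⊗ (ε ∘ m)) ∘ (b̃_A ⊗ id_A) : A ⟶ A^∨`. -/
def Φ₂ [SovereignCategory C] (A : Mon C) [ComonObj A.X] : A.X ⟶ dual A.X :=
  (λ_ A.X).inv ≫ b' A.X ▷ A.X ≫ (α_ (dual A.X) A.X A.X).hom ≫
    dual A.X ◁ (MonObj.mul ≫ ComonObj.counit) ≫ (ρ_ (dual A.X)).hom

/-- `A` is a symmetric algebra. -/
def IsSymmetric [SovereignCategory C] (A : Mon C) [ComonObj A.X] : Prop := Φ₁ A = Φ₂ A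

/-- `A` is absolutely simple: every bimodule endomorphism of `A` is a scalar. -/
def IsAbsolutelySimple (k : Type w) [Field k] [Preadditive C] [Linear k C] (A : Mon C) : Prop :=
  ∀ f : Bimod.regular A ⟶ Bimod.regular A, ∃ c : k, f.hom = c • 𝟙 A.X

end Frobenius

/-! ### Duality and dimension in the category of bimodules -/

section Dimension

open SovereignCategory

variable {C : Type u} [Category.{v} C] [MonoidalCategory C] [SovereignCategory C]
variable {A : Mon C} (M : Bimod A A)

/-- The right action of `A` on `M^∨`, obtained from the left action on `M` by the right duality. -/
def dualActRight : dual M.X ⊗ A.X ⟶ dual M.X :=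
  𝟙 _ ⊗≫ (dual M.X ⊗ A.X) ◁ b M.X ⊗≫ dual M.X ◁ M.actLeft ▷ dual M.X ⊗≫ d M.X ▷ dual M.X ⊗≫ 𝟙 _

/-- The left action of `A` on `M^∨`, obtained from the right action on `M` by the left duality. -/
def dualActLeft : A.X ⊗ dual M.X ⟶ dual M.X :=
  𝟙 _ ⊗≫ b' M.X ▷ (A.X ⊗ dual M.X) ⊗≫ dual M.X ◁ M.actRight ▷ dual M.X ⊗≫ dual M.X ◁ d' M.X ⊗≫ 𝟙 _

theorem dualActRight_d :
    dualActRight M ▷ M.X ≫ d M.X = (α_ _ _ _).hom ≫ dual M.X ◁ M.actLeft ≫ d M.X := by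
  calc
    _ = 𝟙 _ ⊗≫ (dual M.X ⊗ A.X) ◁ b M.X ▷ M.X ⊗≫ dual M.X ◁ M.actLeft ▷ dual M.X ▷ M.X ⊗≫
        (d M.X ▷ (dual M.X ⊗ M.X) ≫ 𝟙_ C ◁ d M.X) ⊗≫ 𝟙 _ := by
      dsimp only [dualActRight]; monoidal
    _ = 𝟙 _ ⊗≫ (dual M.X ⊗ A.X) ◁ b M.X ▷ M.X ⊗≫
        dual M.X ◁ (M.actLeft ▷ (dual M.X ⊗ M.X) ≫ M.X ◁ d M.X) ⊗≫ d M.X ⊗≫ 𝟙 _ := by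
      rw [← whisker_exchange]; monoidal
    _ = 𝟙 _ ⊗≫ (dual M.X ⊗ A.X) ◁ (b M.X ▷ M.X ⊗≫ M.X ◁ d M.X) ⊗≫
        dual M.X ◁ M.actLeft ⊗≫ d M.X ⊗≫ 𝟙 _ := by
      rw [← whisker_exchange]; monoidal
    _ = _ := by rw [b_d]; monoidal

theorem dualActLeft_d' :
    M.X ◁ dualActLeft M ≫ d' M.X = (α_ _ _ _).inv ≫ M.actRight ▷ dual M.X ≫ d' M.X := by
  calc
    _ = 𝟙 _ ⊗≫ M.X ◁ b' M.X ▷ (A.X ⊗ dual M.X) ⊗≫ M.X ◁ dual M.X ◁ M.actRight ▷ dual M.X ⊗≫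
        ((M.X ⊗ dual M.X) ◁ d' M.X ≫ d' M.X ▷ 𝟙_ C) ⊗≫ 𝟙 _ := by
      dsimp only [dualActLeft]; monoidal
    _ = 𝟙 _ ⊗≫ M.X ◁ b' M.X ▷ (A.X ⊗ dual M.X) ⊗≫
        ((M.X ⊗ dual M.X) ◁ M.actRight ≫ d' M.X ▷ M.X) ▷ dual M.X ⊗≫ d' M.X ⊗≫ 𝟙 _ := by
      rw [whisker_exchange]; monoidal
    _ = 𝟙 _ ⊗≫ (M.X ◁ b' M.X ⊗≫ d' M.X ▷ M.X) ▷ (A.X ⊗ dual M.X) ⊗≫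
        M.actRight ▷ dual M.X ⊗≫ d' M.X ⊗≫ 𝟙 _ := by
      rw [whisker_exchange]; monoidal
    _ = _ := by rw [b'_d']; monoidal

variable [ComonObj A.X]

/-- `M^∨ ⊗ M ⟶ A`: create `Δ ∘ η` on the right, let its first leg act on `M` and apply `d_M`. -/
def preEv : dual M.X ⊗ M.X ⟶ A.X :=
  𝟙 _ ⊗≫ (dual M.X ⊗ M.X) ◁ (MonObj.one ≫ ComonObj.comul (X := A.X)) ⊗≫
    dual M.X ◁ M.actRight ▷ A.X ⊗≫ d M.X ▷ A.X ⊗≫ 𝟙 _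

/-- `M ⊗ M^∨ ⟶ A`: create `Δ ∘ η` on the left, let its second leg act on `M` and apply `d̃_M`. -/
def preEv' : M.X ⊗ dual M.X ⟶ A.X :=
  𝟙 _ ⊗≫ (MonObj.one ≫ ComonObj.comul (X := A.X)) ▷ (M.X ⊗ dual M.X) ⊗≫
    A.X ◁ M.actLeft ▷ dual M.X ⊗≫ A.X ◁ d' M.X ⊗≫ 𝟙 _

theorem preEv_condition : dualActRight M ▷ M.X ≫ preEv M =
    ((α_ _ _ _).hom ≫ dual M.X ◁ M.actLeft) ≫ preEv M := by
  have hM : M.actLeft ▷ A.X ≫ M.actRight =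
      (α_ A.X M.X A.X).hom ≫ A.X ◁ M.actRight ≫ M.actLeft := M.middle_assoc
  have hd := dualActRight_d M
  have e : (dual M.X ⊗ A.X) ◁ M.actRight ≫ dualActRight M ▷ M.X ≫ d M.X =
      (dual M.X ⊗ A.X) ◁ M.actRight ≫ (α_ _ _ _).hom ≫ dual M.X ◁ M.actLeft ≫ d M.X := by
    rw [hd]
  set c : 𝟙_ C ⟶ A.X ⊗ A.X := MonObj.one ≫ ComonObj.comul
  calc
    _ = 𝟙 _ ⊗≫ (dualActRight M ▷ (M.X ⊗ 𝟙_ C) ≫ dual M.X ◁ (M.X ◁ c)) ⊗≫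
        dual M.X ◁ M.actRight ▷ A.X ⊗≫ d M.X ▷ A.X ⊗≫ 𝟙 _ := by
      dsimp only [preEv]; monoidal
    _ = 𝟙 _ ⊗≫ (dual M.X ⊗ A.X) ◁ (M.X ◁ c) ⊗≫
        (dualActRight M ▷ (M.X ⊗ A.X) ≫ dual M.X ◁ M.actRight) ▷ A.X ⊗≫
        d M.X ▷ A.X ⊗≫ 𝟙 _ := by
      rw [← whisker_exchange]; monoidal
    _ = 𝟙 _ ⊗≫ (dual M.X ⊗ A.X) ◁ (M.X ◁ c) ⊗≫
        ((dual M.X ⊗ A.X) ◁ M.actRight ≫ dualActRight M ▷ M.X ≫ d M.X) ▷ A.X ⊗≫ 𝟙 _ := by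
      rw [← whisker_exchange]; monoidal
    _ = 𝟙 _ ⊗≫ (dual M.X ⊗ A.X) ◁ (M.X ◁ c) ⊗≫
        (dual M.X ◁ ((α_ A.X M.X A.X).hom ≫ A.X ◁ M.actRight ≫ M.actLeft)) ▷ A.X ⊗≫
        d M.X ▷ A.X ⊗≫ 𝟙 _ := by
      rw [e]; monoidal
    _ = 𝟙 _ ⊗≫ dual M.X ◁ ((A.X ⊗ M.X) ◁ c ≫ M.actLeft ▷ (A.X ⊗ A.X)) ⊗≫
        dual M.X ◁ M.actRight ▷ A.X ⊗≫ d M.X ▷ A.X ⊗≫ 𝟙 _ := by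
      rw [← hM]; monoidal
    _ = _ := by
      rw [whisker_exchange]; dsimp only [preEv]; monoidal

theorem preEv'_condition : M.actRight ▷ dual M.X ≫ preEv' M =
    ((α_ _ _ _).hom ≫ M.X ◁ dualActLeft M) ≫ preEv' M := by
  have hM : M.actLeft ▷ A.X ≫ M.actRight =
      (α_ A.X M.X A.X).hom ≫ A.X ◁ M.actRight ≫ M.actLeft := M.middle_assoc
  have e : M.actLeft ▷ (A.X ⊗ dual M.X) ≫ M.X ◁ dualActLeft M ≫ d' M.X =
      M.actLeft ▷ (A.X ⊗ dual M.X) ≫ (α_ _ _ _).inv ≫ M.actRight ▷ dual M.X ≫ d' M.X := by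
    rw [dualActLeft_d']
  set c : 𝟙_ C ⟶ A.X ⊗ A.X := MonObj.one ≫ ComonObj.comul
  symm
  calc
    _ = 𝟙 _ ⊗≫ ((𝟙_ C ⊗ M.X) ◁ dualActLeft M ≫ (c ▷ M.X) ▷ dual M.X) ⊗≫
        A.X ◁ M.actLeft ▷ dual M.X ⊗≫ A.X ◁ d' M.X ⊗≫ 𝟙 _ := by
      dsimp only [preEv']; monoidal
    _ = 𝟙 _ ⊗≫ c ▷ M.X ▷ (A.X ⊗ dual M.X) ⊗≫
        A.X ◁ ((A.X ⊗ M.X) ◁ dualActLeft M ≫ M.actLeft ▷ dual M.X) ⊗≫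
        A.X ◁ d' M.X ⊗≫ 𝟙 _ := by
      rw [whisker_exchange]; monoidal
    _ = 𝟙 _ ⊗≫ c ▷ M.X ▷ (A.X ⊗ dual M.X) ⊗≫
        A.X ◁ (M.actLeft ▷ (A.X ⊗ dual M.X) ≫ M.X ◁ dualActLeft M ≫ d' M.X) ⊗≫ 𝟙 _ := by
      rw [whisker_exchange]; monoidal
    _ = 𝟙 _ ⊗≫ c ▷ M.X ▷ (A.X ⊗ dual M.X) ⊗≫
        A.X ◁ (M.actLeft ▷ A.X ≫ M.actRight) ▷ dual M.X ⊗≫ A.X ◁ d' M.X ⊗≫ 𝟙 _ := by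
      rw [e]; monoidal
    _ = 𝟙 _ ⊗≫ (c ▷ (M.X ⊗ A.X) ≫ (A.X ⊗ A.X) ◁ M.actRight) ▷ dual M.X ⊗≫
        A.X ◁ M.actLeft ▷ dual M.X ⊗≫ A.X ◁ d' M.X ⊗≫ 𝟙 _ := by
      rw [hM]; monoidal
    _ = _ := by
      rw [← whisker_exchange]; dsimp only [preEv']; monoidal

variable [HasCoequalizers C]

/-- `M^∨ ⊗_A M`. -/
noncomputable def dualTensor : C :=
  coequalizer (dualActRight M ▷ M.X) ((α_ _ _ _).hom ≫ dual M.X ◁ M.actLeft)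

/-- `M ⊗_A M^∨`. -/
noncomputable def tensorDual : C :=
  coequalizer (M.actRight ▷ dual M.X) ((α_ _ _ _).hom ≫ M.X ◁ dualActLeft M)

/-- `d_M^A : M^∨ ⊗_A M ⟶ A`. -/
noncomputable def dA : dualTensor M ⟶ A.X := coequalizer.desc (preEv M) (preEv_condition M)

/-- `d̃_M^A : M ⊗_A M^∨ ⟶ A`. -/
noncomputable def dA' : tensorDual M ⟶ A.X := coequalizer.desc (preEv' M) (preEv'_condition M)

/-- `b_M^A : A ⟶ M ⊗_A M^∨`. -/
noncomputable def bA : A.X ⟶ tensorDual M :=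
  𝟙 _ ⊗≫ A.X ◁ b M.X ⊗≫ M.actLeft ▷ dual M.X ≫ coequalizer.π _ _

/-- `b̃_M^A : A ⟶ M^∨ ⊗_A M`. -/
noncomputable def bA' : A.X ⟶ dualTensor M :=
  𝟙 _ ⊗≫ b' M.X ▷ A.X ⊗≫ dual M.X ◁ M.actRight ≫ coequalizer.π _ _

open Classical in
/-- The scalar `c` with `f = c • id`, if there is one (and `0` otherwise). -/
noncomputable def scalarOf (k : Type w) [Field k] [Preadditive C] [Linear k C]
    {X : C} (f : X ⟶ X) : k :=
  if h : ∃ c : k, f = c • 𝟙 X then h.choose else 0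

/-- The left dimension of `M` in `C_{A|A}`: the scalar `d_M^A ∘ b̃_M^A`. -/
noncomputable def leftDim (k : Type w) [Field k] [Preadditive C] [Linear k C] : k :=
  scalarOf k (bA' M ≫ dA M)

/-- The right dimension of `M` in `C_{A|A}`: the scalar `d̃_M^A ∘ b_M^A`. -/
noncomputable def rightDim (k : Type w) [Field k] [Preadditive C] [Linear k C] : k :=
  scalarOf k (bA M ≫ dA' M)

end Dimension

end BimodPicard

/-! Tensoring with an element of `H` permutes the summands of M = ⨁ L_h, so L_h ⊗_A M ≅ M. The dual
of M is N = ⨁ L_{h⁻¹}, and A' = N ⊗_A M is the algebra of internal endomorphisms of M: morphisms Z ⟶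
N ⊗_A M correspond to morphisms M ⊗_A Z ⟶ M (`hom_ext_dualAct`). An isomorphism u : L ⊗_A M ≅ M
conjugates the action of A' on M into a second action, which this correspondence turns into an
algebra endomorphism `twist u`; invertibility of L makes it an automorphism (`isIso_twist`). Through
u, the bimodule N ⊗_A L ⊗_A M becomes N ⊗_A M with its left action unchanged and its right action
twisted (`twistedBimodIso`).

For the Morita context, N ⊗_A M is A' by construction. For M ⊗_{A'} N ≅ A it suffices that the
evaluation M ⊗_A N ⟶ A has a section, and it has one because each L_h ⊗_A L_{h⁻¹} evaluates
isomorphically. Such a section makes the evaluation a split coequalizer of the two actions of A'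
(`exists_splitting`).

The algebra is done in an arbitrary monoidal category and carried from C_{A|A} to C by the forgetful
functor, which is lax monoidal with the projections M ⊗ N ⟶ M ⊗_A N as tensorator. These projections
are epimorphisms, and stay so after whiskering, so identities in C are checked after precomposing
with them. -/

namespace BimodPicard

/-! ### Projections onto relative tensor products, and the lax monoidal forgetful functor -/

section TensorProjection

variable {C : Type u} [Category.{v} C] [MonoidalCategory C] [HasCoequalizers C]
  [∀ X : C, PreservesColimitsOfSize.{0, 0} (tensorLeft X)]
  [∀ X : C, PreservesColimitsOfSize.{0, 0} (tensorRight X)]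
variable {R S T U : Mon C}

/-- The projection `P ⊗ Q ⟶ P ⊗_S Q`. -/
noncomputable def tensorπ (P : Bimod R S) (Q : Bimod S T) :
    P.X ⊗ Q.X ⟶ (P.tensorBimod Q).X :=
  coequalizer.π (P.actRight ▷ Q.X) ((α_ _ _ _).hom ≫ (P.X ◁ Q.actLeft))

variable (P : Bimod R S) (Q : Bimod S T)

instance epi_tensorπ : Epi (tensorπ P Q) :=
  inferInstanceAs (Epi (coequalizer.π (P.actRight ▷ Q.X) ((α_ _ _ _).hom ≫ (P.X ◁ Q.actLeft))))

/-- Tensoring preserves colimits, hence epimorphisms. -/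
instance epi_whiskerLeft {X Y : C} (f : X ⟶ Y) [Epi f] (Z : C) : Epi (Z ◁ f) :=
  inferInstanceAs (Epi ((tensorLeft Z).map f))

instance epi_whiskerRight {X Y : C} (f : X ⟶ Y) [Epi f] (Z : C) : Epi (f ▷ Z) :=
  inferInstanceAs (Epi ((tensorRight Z).map f))

theorem tensorπ_condition :
    P.actRight ▷ Q.X ≫ tensorπ P Q = (α_ _ _ _).hom ≫ P.X ◁ Q.actLeft ≫ tensorπ P Q := by
  rw [← Category.assoc (α_ _ _ _).hom]
  exact coequalizer.condition _ _

/-- The morphism out of `P ⊗_S Q` induced by a balanced morphism. -/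
noncomputable def tensorDesc {Z : C} (f : P.X ⊗ Q.X ⟶ Z)
    (h : P.actRight ▷ Q.X ≫ f = (α_ _ _ _).hom ≫ P.X ◁ Q.actLeft ≫ f) :
    (P.tensorBimod Q).X ⟶ Z :=
  coequalizer.desc f (by rw [h, Category.assoc])

theorem tensorπ_desc {Z : C} (f : P.X ⊗ Q.X ⟶ Z)
    (h : P.actRight ▷ Q.X ≫ f = (α_ _ _ _).hom ≫ P.X ◁ Q.actLeft ≫ f) :
    tensorπ P Q ≫ tensorDesc P Q f h = f :=
  coequalizer.π_desc _ _

theorem whiskerLeft_tensorπ_actLeft :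
    R.X ◁ tensorπ P Q ≫ (P.tensorBimod Q).actLeft =
      (α_ _ _ _).inv ≫ P.actLeft ▷ Q.X ≫ tensorπ P Q :=
  Bimod.TensorBimod.whiskerLeft_π_actLeft P Q

theorem tensorπ_whiskerRight_actRight :
    tensorπ P Q ▷ T.X ≫ (P.tensorBimod Q).actRight =
      (α_ _ _ _).hom ≫ P.X ◁ Q.actRight ≫ tensorπ P Q :=
  Bimod.TensorBimod.π_tensor_id_actRight P Q

theorem tensorπ_whiskerLeft {Q Q' : Bimod S T} (f : Q ⟶ Q') :
    tensorπ P Q ≫ (Bimod.whiskerLeft P f).hom = P.X ◁ f.hom ≫ tensorπ P Q' :=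
  ι_colimMap _ _

theorem tensorπ_whiskerRight {P P' : Bimod R S} (f : P ⟶ P') (Q : Bimod S T) :
    tensorπ P Q ≫ (Bimod.whiskerRight f Q).hom = f.hom ▷ Q.X ≫ tensorπ P' Q :=
  ι_colimMap _ _

theorem tensorπ_leftUnitor :
    tensorπ (Bimod.regular R) P ≫ (Bimod.leftUnitorBimod P).hom.hom = P.actLeft :=
  coequalizer.π_desc _ _

theorem tensorπ_rightUnitor :
    tensorπ P (Bimod.regular S) ≫ (Bimod.rightUnitorBimod P).hom.hom = P.actRight :=
  coequalizer.π_desc _ _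

theorem tensorπ_associator (L : Bimod T U) :
    tensorπ P Q ▷ L.X ≫ tensorπ (P.tensorBimod Q) L ≫ (Bimod.associatorBimod P Q L).hom.hom =
      (α_ _ _ _).hom ≫ P.X ◁ tensorπ Q L ≫ tensorπ P (Q.tensorBimod L) := by
  have h : tensorπ (P.tensorBimod Q) L ≫ (Bimod.associatorBimod P Q L).hom.hom =
      Bimod.AssociatorBimod.homAux P Q L := coequalizer.π_desc _ _
  rw [h]
  exact π_tensor_id_preserves_coequalizer_inv_desc _ _ _ _

/-- The forgetful functor from `C_{A|A}` to `C`. -/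
abbrev forgetBimod (A : Mon C) : Bimod A A ⥤ C := Bimod.forget (A := A) (B := A)

/-- The forgetful functor is lax monoidal with the projections as tensorator. -/
noncomputable instance forgetBimodLaxMonoidal (A : Mon C) : (forgetBimod A).LaxMonoidal where
  ε := MonObj.one (X := A.X)
  μ M N := tensorπ M N
  μ_natural_left f N := (tensorπ_whiskerRight f N).symm
  μ_natural_right M f := (tensorπ_whiskerLeft M f).symm
  associativity M N K := tensorπ_associator M N K
  left_unitality M := by
    refine (Bimod.one_actLeft M).symm.trans ?_
    rw [← tensorπ_leftUnitor M]
    rfl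
  right_unitality M := by
    refine (Bimod.actRight_one M).symm.trans ?_
    rw [← tensorπ_rightUnitor M]
    rfl

end TensorProjection

/-! ### The internal endomorphism algebra of an object with a dual, and its twists -/

section InternalEnd

variable {D : Type u} [Category.{v} D] [MonoidalCategory D] (N M : D) [ExactPairing N M]

/-- The right action of `N ⊗ M` on `M`, for `N` dual to `M`. -/
def dualAct : M ⊗ (N ⊗ M) ⟶ M := (α_ M N M).inv ≫ ε_ N M ▷ M ≫ (λ_ M).hom

/-- The left action of `N ⊗ M` on `N`, for `N` dual to `M`. -/
def dualCoact : (N ⊗ M) ⊗ N ⟶ N := (α_ N M N).hom ≫ N ◁ ε_ N M ≫ (ρ_ N).hom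

theorem coevaluation_dualAct : M ◁ η_ N M ≫ dualAct N M = (ρ_ M).hom := by
  have h := ExactPairing.coevaluation_evaluation N M
  rw [dualAct, reassoc_of% h]
  simp

theorem coevaluation_dualCoact : η_ N M ▷ N ≫ dualCoact N M = (λ_ N).hom := by
  have h := ExactPairing.evaluation_coevaluation N M
  rw [dualCoact, reassoc_of% h]
  simp

/-- The multiplication of the algebra `N ⊗ M`. -/
def internalMul : (N ⊗ M) ⊗ (N ⊗ M) ⟶ N ⊗ M := (α_ N M (N ⊗ M)).hom ≫ N ◁ dualAct N M

/-- The algebra `N ⊗ M` of internal endomorphisms of `M`, for `N` dual to `M`. -/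
def internalEnd : Mon D where
  X := N ⊗ M
  mon :=
    { one := η_ N M
      mul := internalMul N M
      one_mul := by
        have h := ExactPairing.evaluation_coevaluation N M
        calc
          _ = 𝟙 _ ⊗≫ (η_ N M ▷ N ≫ (α_ N M N).hom ≫ N ◁ ε_ N M) ▷ M ⊗≫ 𝟙 _ := by
            rw [internalMul, dualAct]; monoidal
          _ = _ := by rw [h]; monoidal
      mul_one := by
        rw [internalMul]
        rw [← Category.assoc, tensor_whiskerLeft]
        simp only [Category.assoc, Iso.inv_hom_id_assoc]
        rw [← whiskerLeft_comp, coevaluation_dualAct]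
        monoidal
      mul_assoc := by
        simp only [internalMul, dualAct]
        calc
          _ = 𝟙 _ ⊗≫ N ◁ (ε_ N M ▷ (M ⊗ N) ≫ 𝟙_ D ◁ ε_ N M) ▷ M ⊗≫ 𝟙 _ := by monoidal
          _ = _ := by rw [← whisker_exchange]; monoidal }

theorem mul_dualAct :
    M ◁ internalMul N M ≫ dualAct N M =
      (α_ _ _ _).inv ≫ dualAct N M ▷ (N ⊗ M) ≫ dualAct N M := by
  simp only [internalMul, dualAct]
  symm
  calc
    _ = 𝟙 _ ⊗≫ (ε_ N M ▷ (M ⊗ N) ≫ 𝟙_ D ◁ ε_ N M) ▷ M ⊗≫ 𝟙 _ := by monoidal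
    _ = _ := by rw [← whisker_exchange]; monoidal

theorem mul_dualCoact :
    internalMul N M ▷ N ≫ dualCoact N M =
      (α_ _ _ _).hom ≫ (N ⊗ M) ◁ dualCoact N M ≫ dualCoact N M := by
  simp only [internalMul, dualAct, dualCoact]
  calc
    _ = 𝟙 _ ⊗≫ N ◁ (ε_ N M ▷ (M ⊗ N) ≫ 𝟙_ D ◁ ε_ N M) ⊗≫ 𝟙 _ := by monoidal
    _ = _ := by rw [← whisker_exchange]; monoidal

/-- The multiplication of `N ⊗ M` in terms of the left action on `N`. -/
theorem mul_eq_dualCoact :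
    internalMul N M = (α_ (N ⊗ M) N M).inv ≫ dualCoact N M ▷ M := by
  simp only [internalMul, dualAct, dualCoact]
  monoidal

/-- Both sides evaluate two disjoint pairs M ⊗ N, in different orders. This is what lets the
evaluation descend to the tensor product over `N ⊗ M`. -/
theorem dualAct_evaluation :
    dualAct N M ▷ N ≫ ε_ N M = (α_ _ _ _).hom ≫ M ◁ dualCoact N M ≫ ε_ N M := by
  simp only [dualAct, dualCoact]
  calc
    _ = 𝟙 _ ⊗≫ (ε_ N M ▷ (M ⊗ N) ≫ 𝟙_ D ◁ ε_ N M) ⊗≫ 𝟙 _ := by monoidal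
    _ = _ := by rw [← whisker_exchange]; monoidal

/-- A section of the evaluation splits the pair of actions of `N ⊗ M` on `M ⊗ N`. -/
theorem exists_splitting {s : 𝟙_ D ⟶ M ⊗ N} (hs : s ≫ ε_ N M = 𝟙 _) :
    ∃ j : M ⊗ N ⟶ (M ⊗ (N ⊗ M)) ⊗ N,
      j ≫ dualAct N M ▷ N = ε_ N M ≫ s ∧
      j ≫ (α_ _ _ _).hom ≫ M ◁ dualCoact N M = 𝟙 (M ⊗ N) := by
  -- The section `s` creates a second pair M ⊗ N on the right. Acting on M evaluates the original
  -- pair and leaves the new one; acting on N evaluates the new pair and leaves the original.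
  refine ⟨𝟙 _ ⊗≫ (M ⊗ N) ◁ s ⊗≫ 𝟙 _, ?_, ?_⟩
  · simp only [dualAct]
    calc
      _ = 𝟙 _ ⊗≫ ((M ⊗ N) ◁ s ≫ ε_ N M ▷ (M ⊗ N)) ⊗≫ 𝟙 _ := by monoidal
      _ = _ := by rw [whisker_exchange]; monoidal
  · simp only [dualCoact]
    calc
      _ = 𝟙 _ ⊗≫ (M ⊗ N) ◁ (s ≫ ε_ N M) ⊗≫ 𝟙 _ := by monoidal
      _ = _ := by rw [hs]; monoidal

variable {N M}

/-- By duality `N ⊗ M` represents Z ↦ Hom(M ⊗ Z, M), with `dualAct` as universal element. -/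
theorem hom_ext_dualAct {Z : D} {f g : Z ⟶ N ⊗ M}
    (h : M ◁ f ≫ dualAct N M = M ◁ g ≫ dualAct N M) : f = g :=
  (tensorLeftHomEquiv Z N M M).symm.injective h

variable {L L' : D}

/-- The right action of `N ⊗ M` on `M` transported along `L ⊗ M ≅ M`. -/
def twistedAct (u : L ⊗ M ≅ M) : M ⊗ (N ⊗ M) ⟶ M :=
  u.inv ▷ (N ⊗ M) ≫ (α_ _ _ _).hom ≫ L ◁ dualAct N M ≫ u.hom

/-- The endomorphism of `N ⊗ M` that turns the action on `M` into the transported one. -/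
def twist (u : L ⊗ M ≅ M) : N ⊗ M ⟶ N ⊗ M := tensorLeftHomEquiv _ N M M (twistedAct u)

theorem twist_dualAct (u : L ⊗ M ≅ M) : M ◁ twist u ≫ dualAct N M = twistedAct u :=
  (tensorLeftHomEquiv _ N M M).symm_apply_apply (twistedAct u)

theorem coevaluation_twist (u : L ⊗ M ≅ M) : η_ N M ≫ twist u = η_ N M := by
  apply hom_ext_dualAct
  rw [whiskerLeft_comp, Category.assoc, twist_dualAct, twistedAct, whisker_exchange_assoc,
    coevaluation_dualAct, tensor_whiskerLeft_assoc, Iso.inv_hom_id_assoc,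
    ← whiskerLeft_comp_assoc, coevaluation_dualAct]
  simp

/-- Both sides are compared through their action on M. The action conjugated by `u` is again
associative, so acting by a product is acting twice. -/
theorem mul_twist (u : L ⊗ M ≅ M) :
    internalMul N M ≫ twist u = (twist u ⊗ₘ twist u) ≫ internalMul N M := by
  apply hom_ext_dualAct
  have h1 : M ◁ internalMul N M ≫ twistedAct u =
      u.inv ▷ ((N ⊗ M) ⊗ (N ⊗ M)) ≫ (α_ _ _ _).hom ≫
        L ◁ (M ◁ internalMul N M ≫ dualAct N M) ≫ u.hom := by
    rw [twistedAct, whisker_exchange_assoc]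
    simp
  have h2 : M ◁ ((twist u ⊗ₘ twist u) ≫ internalMul N M) ≫ dualAct N M =
      (α_ _ _ _).inv ≫ (M ◁ twist u ≫ dualAct N M) ▷ (N ⊗ M) ≫
        M ◁ twist u ≫ dualAct N M := by
    rw [whiskerLeft_comp, Category.assoc, mul_dualAct, comp_whiskerRight, Category.assoc,
      ← whisker_exchange_assoc]
    simp [MonoidalCategory.tensorHom_def]
  rw [h2, twist_dualAct, whiskerLeft_comp, Category.assoc, twist_dualAct, h1, mul_dualAct]
  simp only [twistedAct, comp_whiskerRight, Category.assoc, hom_inv_whiskerRight_assoc]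
  monoidal

/-- Conjugating by `u` and then by `u'` is conjugating by `L' ◁ u ≫ u'`. By `h` this composite only
involves `p` and coherence isomorphisms, and `p` slides past the action and cancels. -/
theorem twist_comp_twist (u : L ⊗ M ≅ M) (u' : L' ⊗ M ≅ M) (p : L' ⊗ L ≅ 𝟙_ D)
    (h : L' ◁ u.hom ≫ u'.hom = (α_ _ _ _).inv ≫ p.hom ▷ M ≫ (λ_ M).hom) :
    twist u ≫ twist u' = 𝟙 (N ⊗ M) := by
  apply hom_ext_dualAct
  have h' : u'.inv ≫ L' ◁ u.inv = (λ_ M).inv ≫ p.inv ▷ M ≫ (α_ _ _ _).hom := by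
    rw [← cancel_mono (L' ◁ u.hom ≫ u'.hom)]
    conv_rhs => rw [h]
    simp
  have e : M ◁ (twist u ≫ twist u') ≫ dualAct N M =
      (u'.inv ≫ L' ◁ u.inv) ▷ (N ⊗ M) ≫ (α_ _ _ _).hom ≫ L' ◁ ((α_ _ _ _).hom ≫
        L ◁ dualAct N M) ≫ L' ◁ u.hom ≫ u'.hom := by
    rw [whiskerLeft_comp, Category.assoc, twist_dualAct]
    conv_lhs => rw [twistedAct, whisker_exchange_assoc, tensor_whiskerLeft_assoc,
      Iso.inv_hom_id_assoc, ← whiskerLeft_comp_assoc, twist_dualAct, twistedAct]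
    simp
  rw [e, h', h]
  calc
    _ = (λ_ M).inv ▷ (N ⊗ M) ≫ p.inv ▷ M ▷ (N ⊗ M) ≫ (α_ _ _ _).hom ≫
        ((L' ⊗ L) ◁ dualAct N M ≫ p.hom ▷ M) ≫ (λ_ M).hom := by
      monoidal
    _ = 𝟙 _ ⊗≫ ((p.inv ≫ p.hom) ▷ (M ⊗ (N ⊗ M)) ≫ 𝟙_ D ◁ dualAct N M) ⊗≫ 𝟙 _ := by
      rw [whisker_exchange]; monoidal
    _ = _ := by
      rw [Iso.inv_hom_id]; monoidal

/-- A twist by an invertible object has a one-sided inverse that is again such a twist; using this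
twice makes the inverse two-sided. Hence `p` and `q` need not satisfy any triangle identity. -/
theorem isIso_twist (u : L ⊗ M ≅ M) (p : L' ⊗ L ≅ 𝟙_ D) (q : L ⊗ L' ≅ 𝟙_ D) :
    IsIso (twist (N := N) u) := by
  have key : ∀ {K K' : D} (v : K ⊗ M ≅ M) (r : K' ⊗ K ≅ 𝟙_ D),
      ∃ v' : K' ⊗ M ≅ M, twist (N := N) v ≫ twist v' = 𝟙 (N ⊗ M) := by
    intro K K' v r
    refine ⟨whiskerLeftIso K' v.symm ≪≫ (α_ _ _ _).symm ≪≫ whiskerRightIso r M ≪≫ λ_ M,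
      twist_comp_twist v _ r ?_⟩
    simp
  obtain ⟨u', h⟩ := key u p
  obtain ⟨u'', h'⟩ := key u' q
  have e : twist (N := N) u = twist u'' := by
    rw [← Category.comp_id (twist u), ← h', ← Category.assoc, h, Category.id_comp]
  exact ⟨twist u', h, by rw [e, h']⟩

/-- The automorphism of the algebra `N ⊗ M` induced by `L ⊗ M ≅ M` with `L` invertible. -/
noncomputable def twistIso (u : L ⊗ M ≅ M) (p : L' ⊗ L ≅ 𝟙_ D) (q : L ⊗ L' ≅ 𝟙_ D) :
    internalEnd N M ≅ internalEnd N M :=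
  haveI := isIso_twist (N := N) u p q
  Mon.mkIso (M := internalEnd N M) (N := internalEnd N M)
    (@asIso D _ (N ⊗ M) (N ⊗ M) (twist u) _) (coevaluation_twist u) (mul_twist u)

end InternalEnd

/-! ### Duals of finite direct sums -/

section Biproduct

variable {D : Type u} [Category.{v} D] [MonoidalCategory D] [Preadditive D] [MonoidalPreadditive D]
  [HasFiniteBiproducts D] {J : Type} [Fintype J]

noncomputable instance exactPairingBiproduct (X Y : J → D) [∀ j, ExactPairing (X j) (Y j)] :
    ExactPairing (⨁ X) (⨁ Y) where
  coevaluation' := ∑ j, η_ (X j) (Y j) ≫ (biproduct.ι X j ⊗ₘ biproduct.ι Y j)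
  evaluation' := ∑ j, (biproduct.π Y j ⊗ₘ biproduct.π X j) ≫ ε_ (X j) (Y j)
  coevaluation_evaluation' := by
    classical
    -- The zigzag is a double sum. Sliding the inclusions and projections together makes ι_j ≫ π_k
    -- appear between the two pairings: mixed terms vanish, and diagonal ones reduce to the zigzag
    -- of the j-th pair.
    have h : ∀ j k, (⨁ Y) ◁ (η_ (X j) (Y j) ≫ (biproduct.ι X j ⊗ₘ biproduct.ι Y j)) ≫
        (α_ _ _ _).inv ≫ ((biproduct.π Y k ⊗ₘ biproduct.π X k) ≫ ε_ (X k) (Y k)) ▷ (⨁ Y) =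
        if j = k then (ρ_ _).hom ≫ (biproduct.π Y j ≫ biproduct.ι Y j) ≫ (λ_ _).inv else 0 := by
      intro j k
      have e : (⨁ Y) ◁ (η_ (X j) (Y j) ≫ (biproduct.ι X j ⊗ₘ biproduct.ι Y j)) ≫
          (α_ _ _ _).inv ≫ ((biproduct.π Y k ⊗ₘ biproduct.π X k) ≫ ε_ (X k) (Y k)) ▷ (⨁ Y) =
          biproduct.π Y k ▷ 𝟙_ D ≫ Y k ◁ η_ (X j) (Y j) ≫ (α_ _ _ _).inv ≫
            (Y k ◁ (biproduct.ι X j ≫ biproduct.π X k)) ▷ Y j ≫ ε_ (X k) (Y k) ▷ Y j ≫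
              𝟙_ D ◁ biproduct.ι Y j := by
        simp only [MonoidalCategory.tensorHom_def]
        calc
          _ = (⨁ Y) ◁ η_ (X j) (Y j) ⊗≫ ((⨁ Y) ◁ (biproduct.ι X j ▷ Y j ≫ (⨁ X) ◁ biproduct.ι Y j) ≫
              biproduct.π Y k ▷ ((⨁ X) ⊗ (⨁ Y))) ⊗≫ Y k ◁ biproduct.π X k ▷ (⨁ Y) ⊗≫
              ε_ (X k) (Y k) ▷ (⨁ Y) := by monoidal
          _ = ((⨁ Y) ◁ η_ (X j) (Y j) ≫ biproduct.π Y k ▷ (X j ⊗ Y j)) ⊗≫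
              Y k ◁ biproduct.ι X j ▷ Y j ⊗≫ ((Y k ⊗ (⨁ X)) ◁ biproduct.ι Y j ≫
              (Y k ◁ biproduct.π X k ≫ ε_ (X k) (Y k)) ▷ (⨁ Y)) := by
            rw [whisker_exchange]; monoidal
          _ = _ := by
            rw [whisker_exchange, whisker_exchange]; monoidal
      by_cases hjk : j = k
      · subst hjk
        rw [e, if_pos rfl, biproduct.ι_π_self]
        simp
      · rw [e, if_neg hjk, biproduct.ι_π_ne _ hjk]
        simp
    simp only [whiskerLeft_sum, sum_whiskerRight, Preadditive.sum_comp, Preadditive.comp_sum, h]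
    simp only [Finset.sum_ite_eq', Finset.mem_univ, if_true]
    rw [← Preadditive.comp_sum, ← Preadditive.sum_comp, biproduct.total, Category.id_comp]
  evaluation_coevaluation' := by
    classical
    have h : ∀ j k, (η_ (X j) (Y j) ≫ (biproduct.ι X j ⊗ₘ biproduct.ι Y j)) ▷ (⨁ X) ≫
        (α_ _ _ _).hom ≫ (⨁ X) ◁ ((biproduct.π Y k ⊗ₘ biproduct.π X k) ≫ ε_ (X k) (Y k)) =
        if j = k then (λ_ _).hom ≫ (biproduct.π X j ≫ biproduct.ι X j) ≫ (ρ_ _).inv else 0 := by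
      intro j k
      have e : (η_ (X j) (Y j) ≫ (biproduct.ι X j ⊗ₘ biproduct.ι Y j)) ▷ (⨁ X) ≫
          (α_ _ _ _).hom ≫ (⨁ X) ◁ ((biproduct.π Y k ⊗ₘ biproduct.π X k) ≫ ε_ (X k) (Y k)) =
          𝟙_ D ◁ biproduct.π X k ≫ η_ (X j) (Y j) ▷ X k ≫ (α_ _ _ _).hom ≫
            X j ◁ ((biproduct.ι Y j ≫ biproduct.π Y k) ▷ X k) ≫ X j ◁ ε_ (X k) (Y k) ≫
              biproduct.ι X j ▷ 𝟙_ D := by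
        simp only [MonoidalCategory.tensorHom_def']
        calc
          _ = η_ (X j) (Y j) ▷ (⨁ X) ⊗≫ ((X j ◁ biproduct.ι Y j ≫ biproduct.ι X j ▷ (⨁ Y)) ▷ (⨁ X) ≫
              ((⨁ X) ⊗ (⨁ Y)) ◁ biproduct.π X k) ⊗≫ (⨁ X) ◁ biproduct.π Y k ▷ X k ⊗≫
              (⨁ X) ◁ ε_ (X k) (Y k) := by monoidal
          _ = (η_ (X j) (Y j) ▷ (⨁ X) ≫ (X j ⊗ Y j) ◁ biproduct.π X k) ⊗≫
              X j ◁ biproduct.ι Y j ▷ X k ⊗≫ (biproduct.ι X j ▷ ((⨁ Y) ⊗ X k) ≫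
              (⨁ X) ◁ (biproduct.π Y k ▷ X k ≫ ε_ (X k) (Y k))) := by
            rw [← whisker_exchange]; monoidal
          _ = _ := by
            rw [← whisker_exchange, ← whisker_exchange]; monoidal
      by_cases hjk : j = k
      · subst hjk
        rw [e, if_pos rfl, biproduct.ι_π_self]
        simp
      · rw [e, if_neg hjk, biproduct.ι_π_ne _ hjk]
        simp
    simp only [whiskerLeft_sum, sum_whiskerRight, Preadditive.sum_comp, Preadditive.comp_sum, h]
    simp only [Finset.sum_ite_eq', Finset.mem_univ, if_true]
    rw [← Preadditive.comp_sum, ← Preadditive.sum_comp, biproduct.total, Category.id_comp]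

end Biproduct

/-! ### Invertible objects are dualizable -/

section Invertible

variable {D : Type u} [Category.{v} D] [MonoidalCategory D] 

/-- An object `Y` inverse to `X` is a dual of `X`. -/
@[reducible]
noncomputable def exactPairingOfIso {X Y : D} (p : 𝟙_ D ≅ X ⊗ Y) (q : Y ⊗ X ≅ 𝟙_ D) :
    ExactPairing X Y :=
  -- The unit `p` is kept and `q` is corrected to satisfy the triangle identities. The evaluation is
  -- therefore an isomorphism, though in general not `q` itself.
  let e : Bicategory.Equivalence (MonoidalSingleObj.star D) (MonoidalSingleObj.star D) :=
    Bicategory.Equivalence.mkOfAdjointifyCounit (B := MonoidalSingleObj D) (f := X) (g := Y) p q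
  { coevaluation' := e.unit.hom
    evaluation' := e.counit.hom
    coevaluation_evaluation' := by
      have := e.right_triangle_hom
      simp [Bicategory.rightZigzag, bicategoricalComp] at this
      exact this
    evaluation_coevaluation' := by
      have := e.left_triangle_hom
      simp [Bicategory.leftZigzag, bicategoricalComp] at this
      exact this }

end Invertible

/-! ### The Morita context between A and N ⊗_A M -/

section Morita

set_option linter.unusedSectionVars false

variable {C : Type u} [Category.{v} C] [MonoidalCategory C] [HasCoequalizers C]
  [∀ X : C, PreservesColimitsOfSize.{0, 0} (tensorLeft X)]
  [∀ X : C, PreservesColimitsOfSize.{0, 0} (tensorRight X)]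
variable {A : Mon C}

/-- The projection `M ⊗ N ⟶ M ⊗_A N`, with target the tensor product in `C_{A|A}`. -/
noncomputable def forgetμ (M N : Bimod A A) : M.X ⊗ N.X ⟶ (M ⊗ N).X := tensorπ M N

instance epi_forgetμ (M N : Bimod A A) : Epi (forgetμ M N) := epi_tensorπ M N

section

variable (M N K : Bimod A A)

theorem forgetμ_whiskerRight {M M' : Bimod A A} (f : M ⟶ M') (N : Bimod A A) :
    forgetμ M N ≫ (f ▷ N).hom = f.hom ▷ N.X ≫ forgetμ M' N :=
  tensorπ_whiskerRight f N

theorem forgetμ_whiskerLeft (M : Bimod A A) {N N' : Bimod A A} (f : N ⟶ N') :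
    forgetμ M N ≫ (M ◁ f).hom = M.X ◁ f.hom ≫ forgetμ M N' :=
  tensorπ_whiskerLeft M f

theorem forgetμ_associator_hom :
    forgetμ M N ▷ K.X ≫ forgetμ (M ⊗ N) K ≫ (α_ M N K).hom.hom =
      (α_ _ _ _).hom ≫ M.X ◁ forgetμ N K ≫ forgetμ M (N ⊗ K) :=
  tensorπ_associator M N K

theorem forgetμ_associator_inv :
    M.X ◁ forgetμ N K ≫ forgetμ M (N ⊗ K) ≫ (α_ M N K).inv.hom =
      (α_ _ _ _).inv ≫ forgetμ M N ▷ K.X ≫ forgetμ (M ⊗ N) K := by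
  rw [Iso.eq_inv_comp, ← reassoc_of% @forgetμ_associator_hom, ← Bimod.comp_hom',
    Iso.hom_inv_id, Bimod.id_hom', Category.comp_id]

theorem forgetμ_leftUnitor : forgetμ (𝟙_ (Bimod A A)) M ≫ (λ_ M).hom.hom = M.actLeft :=
  tensorπ_leftUnitor M

theorem forgetμ_rightUnitor : forgetμ M (𝟙_ (Bimod A A)) ≫ (ρ_ M).hom.hom = M.actRight :=
  tensorπ_rightUnitor M

theorem whiskerLeft_forgetμ_actLeft :
    A.X ◁ forgetμ M N ≫ (M ⊗ N).actLeft = (α_ _ _ _).inv ≫ M.actLeft ▷ N.X ≫ forgetμ M N :=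
  whiskerLeft_tensorπ_actLeft M N

theorem forgetμ_whiskerRight_actRight :
    forgetμ M N ▷ A.X ≫ (M ⊗ N).actRight = (α_ _ _ _).hom ≫ M.X ◁ N.actRight ≫ forgetμ M N :=
  tensorπ_whiskerRight_actRight M N

end

variable (N M : Bimod A A) [ExactPairing N M]

/-- The morphism in `C` underlying the coevaluation. -/
noncomputable def coevalHom : A.X ⟶ (N ⊗ M).X := (η_ N M).hom

/-- The morphism in `C` underlying the evaluation. -/
noncomputable def evalHom : (M ⊗ N).X ⟶ A.X := (ε_ N M).hom

/-- The algebra in `C` underlying the algebra `N ⊗_A M` in `C_{A|A}`. -/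
noncomputable def endAlg : Mon C := (forgetBimod A).mapMon.obj (internalEnd N M)

/-- The right action of the algebra `N ⊗_A M` on `M` in `C`. -/
noncomputable def endActRight : M.X ⊗ (N ⊗ M).X ⟶ M.X :=
  forgetμ M (N ⊗ M) ≫ (dualAct N M).hom

/-- The left action of the algebra `N ⊗_A M` on `N` in `C`. -/
noncomputable def endActLeft : (N ⊗ M).X ⊗ N.X ⟶ N.X :=
  forgetμ (N ⊗ M) N ≫ (dualCoact N M).hom

/-- The coevaluation is the algebra morphism A ⟶ N ⊗_A M, and restricting the new action along it
recovers the old action of A. -/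
theorem coevaluation_endActRight :
    M.X ◁ coevalHom N M ≫ endActRight N M = M.actRight := by
  have h := reassoc_of% forgetμ_whiskerLeft M (η_ N M)
  replace h := h (dualAct N M).hom
  rw [← Bimod.comp_hom', coevaluation_dualAct, forgetμ_rightUnitor] at h
  exact h.symm

theorem coevaluation_endActLeft :
    coevalHom N M ▷ N.X ≫ endActLeft N M = N.actLeft := by
  have h := reassoc_of% forgetμ_whiskerRight (η_ N M) N
  replace h := h (dualCoact N M).hom
  rw [← Bimod.comp_hom', coevaluation_dualCoact, forgetμ_leftUnitor] at h
  exact h.symm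

/-- `M` as an `A`-`(N ⊗_A M)`-bimodule. -/
noncomputable def moritaLeft : Bimod A (endAlg N M) where
  X := M.X
  actLeft := M.actLeft
  one_actLeft := M.one_actLeft
  left_assoc := M.left_assoc
  actRight := endActRight N M
  actRight_one := by
    change M.X ◁ (MonObj.one (X := A.X) ≫ coevalHom N M) ≫ endActRight N M = (ρ_ M.X).hom
    rw [whiskerLeft_comp_assoc, coevaluation_endActRight, Bimod.actRight_one]
  right_assoc := by
    change M.X ◁ (forgetμ (N ⊗ M) (N ⊗ M) ≫ (internalMul N M).hom) ≫ endActRight N M =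
      (α_ _ _ _).inv ≫ endActRight N M ▷ (N ⊗ M).X ≫ endActRight N M
    simp only [endActRight, whiskerLeft_comp, comp_whiskerRight, Category.assoc]
    rw [← reassoc_of% @forgetμ_whiskerLeft, ← Bimod.comp_hom', mul_dualAct,
      ← reassoc_of% @forgetμ_whiskerRight, Bimod.comp_hom', Bimod.comp_hom',
      reassoc_of% @forgetμ_associator_inv]
  middle_assoc := by
    change M.actLeft ▷ (N ⊗ M).X ≫ endActRight N M =
      (α_ _ _ _).hom ≫ A.X ◁ endActRight N M ≫ M.actLeft
    rw [endActRight, whiskerLeft_comp_assoc, ← Bimod.Hom.left_act_hom,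
      reassoc_of% @whiskerLeft_forgetμ_actLeft, Iso.hom_inv_id_assoc]

/-- `N` as an `(N ⊗_A M)`-`A`-bimodule. -/
noncomputable def moritaRight : Bimod (endAlg N M) A where
  X := N.X
  actLeft := endActLeft N M
  one_actLeft := by
    change (MonObj.one (X := A.X) ≫ coevalHom N M) ▷ N.X ≫ endActLeft N M = (λ_ N.X).hom
    rw [comp_whiskerRight_assoc, coevaluation_endActLeft, Bimod.one_actLeft]
  left_assoc := by
    change (forgetμ (N ⊗ M) (N ⊗ M) ≫ (internalMul N M).hom) ▷ N.X ≫ endActLeft N M =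
      (α_ _ _ _).hom ≫ (N ⊗ M).X ◁ endActLeft N M ≫ endActLeft N M
    simp only [endActLeft, whiskerLeft_comp, comp_whiskerRight, Category.assoc]
    rw [← reassoc_of% @forgetμ_whiskerRight, ← Bimod.comp_hom', mul_dualCoact,
      ← reassoc_of% @forgetμ_whiskerLeft, Bimod.comp_hom', Bimod.comp_hom',
      reassoc_of% @forgetμ_associator_hom]
  actRight := N.actRight
  actRight_one := N.actRight_one
  right_assoc := N.right_assoc
  middle_assoc := by
    change endActLeft N M ▷ A.X ≫ N.actRight =
      (α_ _ _ _).hom ≫ (N ⊗ M).X ◁ N.actRight ≫ endActLeft N M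
    rw [endActLeft, comp_whiskerRight_assoc, ← Bimod.Hom.right_act_hom,
      reassoc_of% @forgetμ_whiskerRight_actRight]

theorem evaluation_balanced :
    endActRight N M ▷ N.X ≫ forgetμ M N ≫ evalHom N M =
      (α_ _ _ _).hom ≫ M.X ◁ endActLeft N M ≫ forgetμ M N ≫ evalHom N M := by
  have h : (dualAct N M ▷ N).hom ≫ evalHom N M =
      (α_ M (N ⊗ M) N).hom.hom ≫ (M ◁ dualCoact N M).hom ≫ evalHom N M :=
    congrArg Bimod.Hom.hom (dualAct_evaluation N M)
  simp only [endActRight, endActLeft, whiskerLeft_comp, comp_whiskerRight, Category.assoc]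
  rw [← reassoc_of% @forgetμ_whiskerRight, h, ← reassoc_of% @forgetμ_whiskerLeft,
    reassoc_of% @forgetμ_associator_hom]

/-- The morphism `M ⊗_{N ⊗_A M} N ⟶ A` induced by the evaluation. -/
noncomputable def moritaEv : ((moritaLeft N M).tensorBimod (moritaRight N M)).X ⟶ A.X :=
  tensorDesc (moritaLeft N M) (moritaRight N M) (forgetμ M N ≫ evalHom N M)
    (evaluation_balanced N M)

/-- The projection `M ⊗ N ⟶ M ⊗_{N ⊗_A M} N`. -/
noncomputable def moritaπ : M.X ⊗ N.X ⟶ ((moritaLeft N M).tensorBimod (moritaRight N M)).X :=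
  tensorπ (moritaLeft N M) (moritaRight N M)

instance epi_moritaπ : Epi (moritaπ N M) := epi_tensorπ _ _

theorem moritaπ_moritaEv : moritaπ N M ≫ moritaEv N M = forgetμ M N ≫ evalHom N M :=
  tensorπ_desc _ _ _ _

theorem moritaπ_condition :
    endActRight N M ▷ N.X ≫ moritaπ N M =
      (α_ _ _ _).hom ≫ M.X ◁ endActLeft N M ≫ moritaπ N M :=
  tensorπ_condition (moritaLeft N M) (moritaRight N M)

/-- The actions of A are restrictions of those of N ⊗_A M, so balancing over N ⊗_A M implies
balancing over A. -/
theorem moritaπ_balanced :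
    M.actRight ▷ N.X ≫ moritaπ N M = (α_ _ _ _).hom ≫ M.X ◁ N.actLeft ≫ moritaπ N M := by
  rw [← coevaluation_endActRight N M, ← coevaluation_endActLeft N M, comp_whiskerRight_assoc,
    whiskerLeft_comp_assoc, moritaπ_condition]
  simp

/-- The projection `M ⊗_A N ⟶ M ⊗_{N ⊗_A M} N`. -/
noncomputable def moritaProj : (M ⊗ N).X ⟶ ((moritaLeft N M).tensorBimod (moritaRight N M)).X :=
  tensorDesc M N (moritaπ N M) (moritaπ_balanced N M)

theorem forgetμ_moritaProj : forgetμ M N ≫ moritaProj N M = moritaπ N M :=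
  tensorπ_desc _ _ _ _

/-- Balancing over N ⊗_A M, moved from C to C_{A|A}, where the splitting by a section of the
evaluation applies. -/
theorem moritaProj_condition :
    (dualAct N M ▷ N).hom ≫ moritaProj N M =
      (α_ M (N ⊗ M) N).hom.hom ≫ (M ◁ dualCoact N M).hom ≫ moritaProj N M := by
  rw [← cancel_epi (forgetμ (M ⊗ (N ⊗ M)) N), ← cancel_epi (forgetμ M (N ⊗ M) ▷ N.X),
    reassoc_of% @forgetμ_whiskerRight, forgetμ_moritaProj, reassoc_of% @forgetμ_associator_hom,
    reassoc_of% @forgetμ_whiskerLeft, forgetμ_moritaProj]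
  simpa [endActRight, endActLeft] using moritaπ_condition N M

theorem moritaProj_moritaEv : moritaProj N M ≫ moritaEv N M = evalHom N M := by
  rw [← cancel_epi (forgetμ M N), reassoc_of% @forgetμ_moritaProj, moritaπ_moritaEv]

variable {N M} in
/-- The morphism in `C` underlying a section of the evaluation. -/
def sectionHom (s : 𝟙_ (Bimod A A) ⟶ M ⊗ N) : A.X ⟶ (M ⊗ N).X := s.hom

variable {N M} in
/-- A section of the evaluation inverts `moritaEv`. -/
noncomputable def moritaEvIso (s : 𝟙_ (Bimod A A) ⟶ M ⊗ N) (hs : s ≫ ε_ N M = 𝟙 _) :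
    ((moritaLeft N M).tensorBimod (moritaRight N M)).X ≅ A.X where
  hom := moritaEv N M
  inv := sectionHom s ≫ moritaProj N M
  hom_inv_id := by
    obtain ⟨j, h₁, h₂⟩ := exists_splitting N M hs
    have h₁' : j.hom ≫ (dualAct N M ▷ N).hom = evalHom N M ≫ sectionHom s :=
      congrArg Bimod.Hom.hom h₁
    have h₂' : j.hom ≫ (α_ M (N ⊗ M) N).hom.hom ≫ (M ◁ dualCoact N M).hom = 𝟙 (M ⊗ N).X :=
      congrArg Bimod.Hom.hom h₂
    rw [← cancel_epi (moritaπ N M), reassoc_of% @moritaπ_moritaEv, ← reassoc_of% h₁',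
      moritaProj_condition, reassoc_of% h₂', forgetμ_moritaProj, Category.comp_id]
  inv_hom_id := by
    rw [Category.assoc, moritaProj_moritaEv]
    exact congrArg Bimod.Hom.hom hs

theorem whiskerLeft_moritaπ_actLeft :
    A.X ◁ moritaπ N M ≫ ((moritaLeft N M).tensorBimod (moritaRight N M)).actLeft =
      (α_ _ _ _).inv ≫ M.actLeft ▷ N.X ≫ moritaπ N M :=
  whiskerLeft_tensorπ_actLeft (moritaLeft N M) (moritaRight N M)

theorem moritaπ_whiskerRight_actRight :
    moritaπ N M ▷ A.X ≫ ((moritaLeft N M).tensorBimod (moritaRight N M)).actRight =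
      (α_ _ _ _).hom ≫ M.X ◁ N.actRight ≫ moritaπ N M :=
  tensorπ_whiskerRight_actRight (moritaLeft N M) (moritaRight N M)

/-- `M ⊗_{N ⊗_A M} N ≅ A` as bimodules, provided that the evaluation has a section. -/
noncomputable def moritaF (s : 𝟙_ (Bimod A A) ⟶ M ⊗ N) (hs : s ≫ ε_ N M = 𝟙 _) :
    (moritaLeft N M).tensorBimod (moritaRight N M) ≅ Bimod.regular A :=
  Bimod.isoOfIso (moritaEvIso s hs)
    (by
      have h : (M ⊗ N).actLeft ≫ evalHom N M = A.X ◁ evalHom N M ≫ MonObj.mul :=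
        (ε_ N M).left_act_hom
      change _ ≫ moritaEv N M = A.X ◁ moritaEv N M ≫ MonObj.mul
      rw [← cancel_epi (A.X ◁ moritaπ N M), reassoc_of% @whiskerLeft_moritaπ_actLeft,
        moritaπ_moritaEv,
        ← whiskerLeft_comp_assoc, moritaπ_moritaEv, whiskerLeft_comp_assoc, ← h,
        reassoc_of% @whiskerLeft_forgetμ_actLeft])
    (by
      have h : (M ⊗ N).actRight ≫ evalHom N M = evalHom N M ▷ A.X ≫ MonObj.mul :=
        (ε_ N M).right_act_hom
      change _ ≫ moritaEv N M = moritaEv N M ▷ A.X ≫ MonObj.mul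
      rw [← cancel_epi (moritaπ N M ▷ A.X), reassoc_of% @moritaπ_whiskerRight_actRight,
        moritaπ_moritaEv,
        ← comp_whiskerRight_assoc, moritaπ_moritaEv, comp_whiskerRight_assoc, ← h,
        reassoc_of% @forgetμ_whiskerRight_actRight])

theorem whiskerLeft_forgetμ_moritaRight_actLeft :
    (N ⊗ M).X ◁ forgetμ N M ≫ ((moritaRight N M).tensorBimod (moritaLeft N M)).actLeft =
      (α_ _ _ _).inv ≫ endActLeft N M ▷ M.X ≫ forgetμ N M :=
  whiskerLeft_tensorπ_actLeft (moritaRight N M) (moritaLeft N M)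

theorem forgetμ_whiskerRight_moritaLeft_actRight :
    forgetμ N M ▷ (N ⊗ M).X ≫ ((moritaRight N M).tensorBimod (moritaLeft N M)).actRight =
      (α_ _ _ _).hom ≫ N.X ◁ endActRight N M ≫ forgetμ N M :=
  tensorπ_whiskerRight_actRight (moritaRight N M) (moritaLeft N M)

theorem forgetμ_mul_left :
    (N ⊗ M).X ◁ forgetμ N M ≫ forgetμ (N ⊗ M) (N ⊗ M) ≫ (internalMul N M).hom =
      (α_ _ _ _).inv ≫ endActLeft N M ▷ M.X ≫ forgetμ N M := by
  rw [mul_eq_dualCoact, Bimod.comp_hom', reassoc_of% @forgetμ_associator_inv, forgetμ_whiskerRight,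
    endActLeft, comp_whiskerRight_assoc]

theorem forgetμ_mul_right :
    forgetμ N M ▷ (N ⊗ M).X ≫ forgetμ (N ⊗ M) (N ⊗ M) ≫ (internalMul N M).hom =
      (α_ _ _ _).hom ≫ N.X ◁ endActRight N M ≫ forgetμ N M := by
  rw [internalMul, Bimod.comp_hom', reassoc_of% @forgetμ_associator_hom, forgetμ_whiskerLeft,
    endActRight, whiskerLeft_comp_assoc]

/-- The two Morita bimodules keep their A-actions, so their tensor product over A has by definition
the same underlying object as `N ⊗ M`; only the actions remain to be compared. -/
theorem moritaRight_moritaLeft_actLeft :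
    (((moritaRight N M).tensorBimod (moritaLeft N M)).actLeft :
      (N ⊗ M).X ⊗ (N ⊗ M).X ⟶ (N ⊗ M).X) =
      forgetμ (N ⊗ M) (N ⊗ M) ≫ (internalMul N M).hom :=
  (cancel_epi ((N ⊗ M).X ◁ forgetμ N M)).1
    ((whiskerLeft_forgetμ_moritaRight_actLeft N M).trans (forgetμ_mul_left N M).symm)

theorem moritaRight_moritaLeft_actRight :
    (((moritaRight N M).tensorBimod (moritaLeft N M)).actRight :
      (N ⊗ M).X ⊗ (N ⊗ M).X ⟶ (N ⊗ M).X) =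
      forgetμ (N ⊗ M) (N ⊗ M) ≫ (internalMul N M).hom :=
  (cancel_epi (forgetμ N M ▷ (N ⊗ M).X)).1
    ((forgetμ_whiskerRight_moritaLeft_actRight N M).trans (forgetμ_mul_right N M).symm)

/-- `N ⊗_A M` is the regular bimodule of the algebra `N ⊗_A M`. -/
noncomputable def moritaG :
    (moritaRight N M).tensorBimod (moritaLeft N M) ≅ Bimod.regular (endAlg N M) :=
  Bimod.isoOfIso (Iso.refl (N ⊗ M).X)
    (by
      have e : (N ⊗ M).X ◁ 𝟙 (N ⊗ M).X ≫ forgetμ (N ⊗ M) (N ⊗ M) ≫ (internalMul N M).hom =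
          forgetμ (N ⊗ M) (N ⊗ M) ≫ (internalMul N M).hom := by
        rw [whiskerLeft_id, Category.id_comp]
      exact (Category.comp_id _).trans ((moritaRight_moritaLeft_actLeft N M).trans e.symm))
    (by
      have e : 𝟙 (N ⊗ M).X ▷ (N ⊗ M).X ≫ forgetμ (N ⊗ M) (N ⊗ M) ≫ (internalMul N M).hom =
          forgetμ (N ⊗ M) (N ⊗ M) ≫ (internalMul N M).hom := by
        rw [id_whiskerRight, Category.id_comp]
      exact (Category.comp_id _).trans ((moritaRight_moritaLeft_actRight N M).trans e.symm))

theorem forgetμ_evalHom_actLeft :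
    forgetμ M N ▷ M.X ≫ evalHom N M ▷ M.X ≫ M.actLeft =
      (α_ _ _ _).hom ≫ M.X ◁ forgetμ N M ≫ endActRight N M := by
  have h : evalHom N M ▷ M.X ≫ M.actLeft =
      forgetμ (M ⊗ N) M ≫ (ε_ N M ▷ M).hom ≫ (λ_ M).hom.hom := by
    rw [reassoc_of% @forgetμ_whiskerRight, forgetμ_leftUnitor]
    rfl
  rw [h, endActRight, ← reassoc_of% @forgetμ_associator_hom]
  simp [dualAct, ← Bimod.comp_hom']

theorem forgetμ_evalHom_actRight :
    forgetμ N M ▷ N.X ≫ endActLeft N M =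
      (α_ _ _ _).hom ≫ N.X ◁ forgetμ M N ≫ N.X ◁ evalHom N M ≫ N.actRight := by
  have h : N.X ◁ evalHom N M ≫ N.actRight =
      forgetμ N (M ⊗ N) ≫ (N ◁ ε_ N M).hom ≫ (ρ_ N).hom.hom := by
    rw [reassoc_of% @forgetμ_whiskerLeft, forgetμ_rightUnitor]
    rfl
  rw [h, endActLeft, ← reassoc_of% @forgetμ_associator_hom]
  simp [dualCoact, ← Bimod.comp_hom']

/-- The Morita context between `A` and the algebra `N ⊗_A M`. -/
noncomputable def moritaContext (s : 𝟙_ (Bimod A A) ⟶ M ⊗ N) (hs : s ≫ ε_ N M = 𝟙 _) :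
    MoritaContext A (endAlg N M) (moritaLeft N M) (moritaRight N M) where
  f := moritaF N M s hs
  g := moritaG N M
  f_g := by
    -- The identity on `(N ⊗ M).X` stands for the morphism underlying `moritaG`.
    have h : moritaπ N M ▷ M.X ≫ moritaEv N M ▷ M.X ≫ M.actLeft =
        (α_ _ _ _).hom ≫ M.X ◁ forgetμ N M ≫ M.X ◁ 𝟙 (N ⊗ M).X ≫ endActRight N M := by
      rw [← comp_whiskerRight_assoc, moritaπ_moritaEv, comp_whiskerRight_assoc,
        forgetμ_evalHom_actLeft, whiskerLeft_id, Category.id_comp]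
    ext
    rw [← cancel_epi (tensorπ ((moritaLeft N M).tensorBimod (moritaRight N M)) (moritaLeft N M)),
      ← cancel_epi (tensorπ (moritaLeft N M) (moritaRight N M) ▷ (moritaLeft N M).X)]
    simp only [Bimod.comp_hom']
    rw [reassoc_of% @tensorπ_whiskerRight, tensorπ_leftUnitor, reassoc_of% @tensorπ_associator,
      reassoc_of% @tensorπ_whiskerLeft, tensorπ_rightUnitor]
    exact h
  g_f := by
    have h : forgetμ N M ▷ N.X ≫ 𝟙 (N ⊗ M).X ▷ N.X ≫ endActLeft N M =
        (α_ _ _ _).hom ≫ N.X ◁ moritaπ N M ≫ N.X ◁ moritaEv N M ≫ N.actRight := by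
      rw [← whiskerLeft_comp_assoc, moritaπ_moritaEv, whiskerLeft_comp_assoc,
        ← forgetμ_evalHom_actRight, id_whiskerRight, Category.id_comp]
    ext
    rw [← cancel_epi (tensorπ ((moritaRight N M).tensorBimod (moritaLeft N M)) (moritaRight N M)),
      ← cancel_epi (tensorπ (moritaRight N M) (moritaLeft N M) ▷ (moritaRight N M).X)]
    simp only [Bimod.comp_hom']
    rw [reassoc_of% @tensorπ_whiskerRight, tensorπ_leftUnitor, reassoc_of% @tensorπ_associator,
      reassoc_of% @tensorπ_whiskerLeft, tensorπ_rightUnitor]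
    exact h

/-! ### Invertible bimodules absorbed by `M` -/

variable {L L' : Bimod A A}

variable (L) in
/-- The bimodule over `N ⊗_A M` corresponding to `L` under the Morita equivalence. -/
noncomputable abbrev moritaConj : Bimod (endAlg N M) (endAlg N M) :=
  ((moritaRight N M).tensorBimod L).tensorBimod (moritaLeft N M)

variable (L) in
/-- The left action of `N ⊗_A M` on `N ⊗_A L ⊗_A M`. -/
noncomputable def conjActLeft : (N ⊗ M).X ⊗ ((N ⊗ L) ⊗ M).X ⟶ ((N ⊗ L) ⊗ M).X :=
  (moritaConj N M L).actLeft

variable (L) in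
/-- The right action of `N ⊗_A M` on `N ⊗_A L ⊗_A M`. -/
noncomputable def conjActRight : ((N ⊗ L) ⊗ M).X ⊗ (N ⊗ M).X ⟶ ((N ⊗ L) ⊗ M).X :=
  (moritaConj N M L).actRight

variable (L) in
theorem whiskerLeft_conjActLeft :
    (N ⊗ M).X ◁ (forgetμ N L ▷ M.X) ≫ (N ⊗ M).X ◁ forgetμ (N ⊗ L) M ≫ conjActLeft N M L =
    (N ⊗ M).X ◁ (α_ _ _ _).hom ≫ (α_ _ _ _).inv ≫ endActLeft N M ▷ (L.X ⊗ M.X) ≫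
      (α_ _ _ _).inv ≫ forgetμ N L ▷ M.X ≫ forgetμ (N ⊗ L) M := by
  let a : (N ⊗ M).X ⊗ (N ⊗ L).X ⟶ (N ⊗ L).X := ((moritaRight N M).tensorBimod L).actLeft
  have h₁ : (N ⊗ M).X ◁ forgetμ (N ⊗ L) M ≫ conjActLeft N M L =
      (α_ _ _ _).inv ≫ a ▷ M.X ≫ forgetμ (N ⊗ L) M :=
    whiskerLeft_tensorπ_actLeft ((moritaRight N M).tensorBimod L) (moritaLeft N M)
  have h₂ : (N ⊗ M).X ◁ forgetμ N L ≫ a = (α_ _ _ _).inv ≫ endActLeft N M ▷ L.X ≫ forgetμ N L :=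
    whiskerLeft_tensorπ_actLeft (moritaRight N M) L
  rw [h₁, associator_inv_naturality_middle_assoc, ← comp_whiskerRight_assoc, h₂]
  monoidal

variable (L) in
theorem whiskerRight_conjActRight :
    (forgetμ N L ▷ M.X) ▷ (N ⊗ M).X ≫ forgetμ (N ⊗ L) M ▷ (N ⊗ M).X ≫ conjActRight N M L =
    (α_ _ _ _).hom ≫ (N.X ⊗ L.X) ◁ endActRight N M ≫ forgetμ N L ▷ M.X ≫ forgetμ (N ⊗ L) M := by
  have h₁ : forgetμ (N ⊗ L) M ▷ (N ⊗ M).X ≫ conjActRight N M L =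
      (α_ _ _ _).hom ≫ (N ⊗ L).X ◁ endActRight N M ≫ forgetμ (N ⊗ L) M :=
    tensorπ_whiskerRight_actRight ((moritaRight N M).tensorBimod L) (moritaLeft N M)
  rw [h₁, associator_naturality_left_assoc, ← whisker_exchange_assoc]

/-- The isomorphism `N ⊗_A L ⊗_A M ≅ N ⊗_A M` induced by `L ⊗_A M ≅ M`. -/
noncomputable def absorbIso (u : L ⊗ M ≅ M) : ((N ⊗ L) ⊗ M).X ≅ (N ⊗ M).X :=
  (Bimod.forget (A := A) (B := A)).mapIso (α_ N L M ≪≫ whiskerLeftIso N u)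

theorem forgetμ_absorbIso (u : L ⊗ M ≅ M) :
    forgetμ N L ▷ M.X ≫ forgetμ (N ⊗ L) M ≫ (absorbIso N M u).hom =
      (α_ _ _ _).hom ≫ N.X ◁ (forgetμ L M ≫ u.hom.hom) ≫ forgetμ N M := by
  change forgetμ N L ▷ M.X ≫ forgetμ (N ⊗ L) M ≫ (α_ N L M).hom.hom ≫ (N ◁ u.hom).hom = _
  rw [reassoc_of% @forgetμ_associator_hom, forgetμ_whiskerLeft, whiskerLeft_comp_assoc]

/-- The left action involves only the factor N and `u` only L ⊗_A M, so they commute and no twist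
appears. -/
theorem conjActLeft_absorbIso (u : L ⊗ M ≅ M) :
    conjActLeft N M L ≫ (absorbIso N M u).hom =
      (N ⊗ M).X ◁ (absorbIso N M u).hom ≫ forgetμ (N ⊗ M) (N ⊗ M) ≫ (internalMul N M).hom := by
  rw [← cancel_epi ((N ⊗ M).X ◁ forgetμ (N ⊗ L) M),
    ← cancel_epi ((N ⊗ M).X ◁ (forgetμ N L ▷ M.X)), reassoc_of% @whiskerLeft_conjActLeft,
    forgetμ_absorbIso, ← whiskerLeft_comp_assoc, ← whiskerLeft_comp_assoc, Category.assoc,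
    forgetμ_absorbIso]
  generalize forgetμ L M ≫ u.hom.hom = v
  rw [whiskerLeft_comp_assoc, whiskerLeft_comp_assoc, forgetμ_mul_left, Iso.inv_hom_id_assoc,
    associator_inv_naturality_right_assoc, whisker_exchange_assoc]

theorem twist_endActRight (u : L ⊗ M ≅ M) :
    u.hom.hom ▷ (N ⊗ M).X ≫ M.X ◁ (twist u).hom ≫ endActRight N M =
      forgetμ (L ⊗ M) (N ⊗ M) ≫ (α_ L M (N ⊗ M)).hom.hom ≫ (L ◁ dualAct N M).hom ≫ u.hom.hom := by
  have h : u.hom ▷ (N ⊗ M) ≫ M ◁ twist u ≫ dualAct N M =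
      (α_ L M (N ⊗ M)).hom ≫ L ◁ dualAct N M ≫ u.hom := by
    rw [twist_dualAct, twistedAct, hom_inv_whiskerRight_assoc]
  have h' := congrArg Bimod.Hom.hom h
  simp only [Bimod.comp_hom'] at h'
  rw [endActRight, ← reassoc_of% @forgetμ_whiskerLeft, ← reassoc_of% @forgetμ_whiskerRight, h']

/-- Here the action and `u` meet on the factor M. Moving `u` across the action is the defining
property of `twist u`. -/
theorem conjActRight_absorbIso (u : L ⊗ M ≅ M) :
    conjActRight N M L ≫ (absorbIso N M u).hom =
      (absorbIso N M u).hom ▷ (N ⊗ M).X ≫ (N ⊗ M).X ◁ (twist u).hom ≫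
        forgetμ (N ⊗ M) (N ⊗ M) ≫ (internalMul N M).hom := by
  have h : (forgetμ L M ≫ u.hom.hom) ▷ (N ⊗ M).X ≫ M.X ◁ (twist u).hom ≫ endActRight N M =
      (α_ _ _ _).hom ≫ L.X ◁ endActRight N M ≫ forgetμ L M ≫ u.hom.hom := by
    rw [comp_whiskerRight_assoc, twist_endActRight, reassoc_of% @forgetμ_associator_hom,
      reassoc_of% @forgetμ_whiskerLeft, endActRight, whiskerLeft_comp_assoc]
  rw [← cancel_epi (forgetμ (N ⊗ L) M ▷ (N ⊗ M).X),
    ← cancel_epi ((forgetμ N L ▷ M.X) ▷ (N ⊗ M).X), reassoc_of% @whiskerRight_conjActRight,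
    forgetμ_absorbIso, ← comp_whiskerRight_assoc, ← comp_whiskerRight_assoc, Category.assoc,
    forgetμ_absorbIso, comp_whiskerRight_assoc, comp_whiskerRight_assoc,
    ← whisker_exchange_assoc, forgetμ_mul_right, associator_naturality_right_assoc,
    associator_naturality_right_assoc, associator_naturality_middle_assoc,
    ← whiskerLeft_comp_assoc, ← whiskerLeft_comp_assoc,
    ← whiskerLeft_comp_assoc, Category.assoc, h]
  simp

/-- The bimodule corresponding to `L` is twisted by an automorphism if `L ⊗_A M ≅ M`. -/
noncomputable def twistedBimodIso (u : L ⊗ M ≅ M) (p : L' ⊗ L ≅ 𝟙_ (Bimod A A))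
    (q : L ⊗ L' ≅ 𝟙_ (Bimod A A)) :
    moritaConj N M L ≅
      twistedBimod (A := endAlg N M) ((forgetBimod A).mapMon.mapIso (twistIso u p q)) :=
  Bimod.isoOfIso (absorbIso N M u) (conjActLeft_absorbIso N M u) (conjActRight_absorbIso N M u)

end Morita

/-! ### Splitting the evaluation, and permuting summands -/

section

variable {D : Type u} [Category.{v} D] [MonoidalCategory D]

theorem isIso_evaluation_exactPairingOfIso {X Y : D} (p : 𝟙_ D ≅ X ⊗ Y) (q : Y ⊗ X ≅ 𝟙_ D) :
    IsIso (@ExactPairing.evaluation D _ _ X Y (exactPairingOfIso p q)) :=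
  (Bicategory.Equivalence.mkOfAdjointifyCounit (B := MonoidalSingleObj D)
    (a := MonoidalSingleObj.star D) (b := MonoidalSingleObj.star D)
    (f := X) (g := Y) p q).counit.isIso_hom

variable [Preadditive D] [MonoidalPreadditive D] [HasFiniteBiproducts D] {J : Type} [Fintype J]

theorem exists_section_evaluation (X Y : J → D) [∀ j, ExactPairing (X j) (Y j)] (j : J)
    [IsIso (ε_ (X j) (Y j))] : ∃ s : 𝟙_ D ⟶ (⨁ Y) ⊗ (⨁ X), s ≫ ε_ (⨁ X) (⨁ Y) = 𝟙 _ := by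
  classical
  -- The inverse of one component of the evaluation, included into the direct sums; the other
  -- components annihilate it.
  refine ⟨inv (ε_ (X j) (Y j)) ≫ (biproduct.ι Y j ⊗ₘ biproduct.ι X j), ?_⟩
  have h : ε_ (⨁ X) (⨁ Y) = ∑ j, (biproduct.π Y j ⊗ₘ biproduct.π X j) ≫ ε_ (X j) (Y j) := rfl
  rw [h, Preadditive.comp_sum, Finset.sum_eq_single j]
  · simp
  · intro k _ hk
    simp [biproduct.ι_π_ne _ (Ne.symm hk)]
  · simp

theorem nonempty_tensor_biproduct_iso (L : D) (M : J → D) (σ : J ≃ J)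
    (w : ∀ j, Nonempty (L ⊗ M j ≅ M (σ j))) : Nonempty (L ⊗ ⨁ M ≅ ⨁ M) :=
  ⟨leftDistributor L M ≪≫ biproduct.whiskerEquiv σ fun j => (w j).some.symm⟩

end

/-! ### Additivity of the tensor product of bimodules -/

section Preadditive

variable {C : Type u} [Category.{v} C] [MonoidalCategory C] [Preadditive C] [MonoidalPreadditive C]
  [HasCoequalizers C]
  [∀ X : C, PreservesColimitsOfSize.{0, 0} (tensorLeft X)]
  [∀ X : C, PreservesColimitsOfSize.{0, 0} (tensorRight X)]

instance monoidalPreadditive_bimod (A : Mon C) : MonoidalPreadditive (Bimod A A) where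
  whiskerLeft_zero {M N K} := by
    ext
    rw [← cancel_epi (forgetμ M N), forgetμ_whiskerLeft]
    simp
  zero_whiskerRight {M N K} := by
    ext
    rw [← cancel_epi (forgetμ N M), forgetμ_whiskerRight]
    simp
  whiskerLeft_add {M N K} f g := by
    ext
    rw [← cancel_epi (forgetμ M N), forgetμ_whiskerLeft]
    simp [MonoidalPreadditive.whiskerLeft_add, forgetμ_whiskerLeft]
  add_whiskerRight {M N K} f g := by
    ext
    rw [← cancel_epi (forgetμ N M), forgetμ_whiskerRight]
    simp [MonoidalPreadditive.add_whiskerRight, forgetμ_whiskerRight]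

end Preadditive

end BimodPicard

/-- With `M = ⨁ L_h` and its dual `N = ⨁ L_{h⁻¹}` one takes `A' = N ⊗_A M`, `P = M`, `P' = N`. The
evaluation `M ⊗_A N ⟶ A` is split by the inverse of one of its components, so that no scalar has to
be inverted and the nonvanishing of the dimension is not needed. -/
theorem mainTheorem10
    (k : Type w) [Field k] [CharZero k]
    (C : Type u) [Category.{v} C] [Abelian C] [Linear k C]
    [MonoidalCategory C] [MonoidalPreadditive C] [MonoidalLinear k C]
    (hfin : ∀ X Y : C, FiniteDimensional k (X ⟶ Y))
    (hsimple : Simple (𝟙_ C))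
    (habs : ∀ f : 𝟙_ C ⟶ 𝟙_ C, ∃ c : k, f = c • 𝟙 (𝟙_ C))
    [BimodPicard.SovereignCategory C]
    (A : Mon C) [ComonObj A.X]
    (hfrob : BimodPicard.IsFrobenius A)
    (hspecial : BimodPicard.IsNormalizedSpecial k A)
    (hsymm : BimodPicard.IsSymmetric A)
    (hAsimple : Simple (Bimod.regular A))
    (hAabs : BimodPicard.IsAbsolutelySimple k A)
    (H : Subgroup (BimodPicard.Pic (Bimod A A))) [Finite H]
    (L : H → Bimod A A)
    (hL : ∀ h : H, toSkeleton (L h) = ((h : BimodPicard.Pic (Bimod A A)) : Skeleton (Bimod A A)))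
    (hdim : BimodPicard.leftDim (⨁ L) k ≠ 0 ∨ BimodPicard.rightDim (⨁ L) k ≠ 0) :
    ∃ (A' : Mon C) (P : Bimod A A') (P' : Bimod A' A),
      Nonempty (BimodPicard.MoritaContext A A' P P') ∧
      ∀ h : H, ∃ β : A' ≅ A',
        Nonempty (BimodPicard.twistedBimod β ≅ (P'.tensorBimod (L h)).tensorBimod P) := by
  -- Only the existence of these isomorphisms matters: they are chosen independently, and no
  -- compatibility between different elements of `H` is required.
  have hmul : ∀ g h : H, Nonempty (L g ⊗ L h ≅ L (g * h)) := fun g h => by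
    refine Quotient.exact ((Skeleton.toSkeleton_tensorObj (L g) (L h)).trans ?_)
    rw [hL, hL]
    exact (hL (g * h)).symm
  have hone : Nonempty (L 1 ≅ 𝟙_ (Bimod A A)) := Quotient.exact (hL 1)
  have hinv : ∀ g h : H, g * h = 1 → Nonempty (L g ⊗ L h ≅ 𝟙_ (Bimod A A)) := fun g h e =>
    ⟨(hmul g h).some ≪≫ eqToIso (congrArg L e) ≪≫ hone.some⟩
  let p : ∀ h, L h⁻¹ ⊗ L h ≅ 𝟙_ (Bimod A A) := fun h => (hinv h⁻¹ h (inv_mul_cancel h)).some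
  let q : ∀ h, L h ⊗ L h⁻¹ ≅ 𝟙_ (Bimod A A) := fun h => (hinv h h⁻¹ (mul_inv_cancel h)).some
  let e := (Finite.equivFin H).symm
  let _ : ∀ j, ExactPairing (L (e j)⁻¹) (L (e j)) := fun j =>
    BimodPicard.exactPairingOfIso (p (e j)).symm (q (e j))
  -- Any index would serve, since every component of the evaluation is invertible; the unit of `H`
  -- provides one.
  let j₀ := e.symm 1
  have : IsIso (ε_ (L (e j₀)⁻¹) (L (e j₀))) :=
    BimodPicard.isIso_evaluation_exactPairingOfIso (p (e j₀)).symm (q (e j₀))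
  obtain ⟨s, hs⟩ := BimodPicard.exists_section_evaluation
    (fun j => L (e j)⁻¹) (fun j => L (e j)) j₀
  refine ⟨_, _, _, ⟨BimodPicard.moritaContext _ _ s hs⟩, fun h => ?_⟩
  -- The summands are permuted by left translation by `h`, transported to the index set.
  obtain ⟨u⟩ := BimodPicard.nonempty_tensor_biproduct_iso (L h) (fun j => L (e j))
    (e.trans ((Equiv.mulLeft h).trans e.symm)) fun j =>
      ⟨(hmul h (e j)).some ≪≫ eqToIso (by simp)⟩
  exact ⟨_, ⟨(BimodPicard.twistedBimodIso _ _ u (p h) (q h)).symm⟩⟩
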